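/- Let $k$ be an algebraically closed field of characteristic zero. For a $k$-algebra automorphism $\sigma$ of $k[h]$ and $a\in k[h]\setminus\{0\}$, the generalized Weyl algebra $k[h](\sigma,a)$ is the $k$-algebra generated over $k[h]$ by two elements $x,y$ subject to the relations $xh=\sigma(h)x$, $yh=\sigma^{-1}(h)y$, $xy=\sigma(a)$, $yx=a$. Let $\sigma_{cl}$ be the automorphism of $k[h]$ with $\sigma_{cl}(h)=h-1$. Let $a_1,a_2\in k[h]\setminus k$ be non-constant polynomials of degrees $n$ and $m$, and write $a_1=c_1\prod_{i=1}^n(h-\alpha_i)$ and $a_2=c_2\prod_{i=1}^m(h-\beta_i)$ with leading coefficients $c_1,c_2\in k^*$ and roots $\alpha_i,\beta_i\in k$ listed with multiplicity. Put $A=k[h](\sigma_{cl},a_1)$ and $B=k[h](\sigma_{cl},a_2)$. Then the following assertions are equivalent: 1. $A$ and $B$ are isomorphic as $k$-algebras; 2. $n=m$, and there exists a permutation $\tau\in\mathcal S_n$ such that $(\alpha_i-\alpha_j)^2=(\beta_{\tau(i)}-\beta_{\tau(j)})^2$ for all $1\le i,j\le n$; 3. $n=m$, and there exist a permutation $\tau\in\mathcal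 S_n$ and $\epsilon\in\{-1,1\}$ such that $\alpha_i-\alpha_1=\epsilon(\beta_{\tau(i)}-\beta_{\tau(1)})$ for all $1\le i\le n$. -/

import Mathlib

open Polynomial

/-- The three generators `h`, `x`, `y` of a generalized Weyl algebra over `k[h]`. -/
inductive GWAGen : Type
  | h
  | x
  | y

section GWADefs

variable {k : Type*} [Field k]

/-- The polynomial `p ∈ k[h]`, seen in the free algebra `k⟨h, x, y⟩` (evaluated at the
generator `h`). -/
noncomputable def GWAGen.poly (p : k[X]) : FreeAlgebra k GWAGen :=
  aeval (FreeAlgebra.ι k GWAGen.h) p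

/-- The defining relations of `k[h](σ, a)`:
`x h = σ(h) x`, `y h = σ⁻¹(h) y`, `x y = σ(a)`, `y x = a`. -/
inductive GWARel (σ : k[X] ≃ₐ[k] k[X]) (a : k[X]) :
    FreeAlgebra k GWAGen → FreeAlgebra k GWAGen → Prop
  | x_h : GWARel σ a (FreeAlgebra.ι k GWAGen.x * FreeAlgebra.ι k GWAGen.h)
      (GWAGen.poly (σ X) * FreeAlgebra.ι k GWAGen.x)
  | y_h : GWARel σ a (FreeAlgebra.ι k GWAGen.y * FreeAlgebra.ι k GWAGen.h)
      (GWAGen.poly (σ.symm X) * FreeAlgebra.ι k GWAGen.y)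
  | x_y : GWARel σ a (FreeAlgebra.ι k GWAGen.x * FreeAlgebra.ι k GWAGen.y)
      (GWAGen.poly (σ a))
  | y_x : GWARel σ a (FreeAlgebra.ι k GWAGen.y * FreeAlgebra.ι k GWAGen.x)
      (GWAGen.poly a)

/-- The generalized Weyl algebra `k[h](σ, a)` of degree one: the `k`-algebra generated over
`k[h]` by `x` and `y` subject to the relations `GWARel σ a`. -/
abbrev GWA (σ : k[X] ≃ₐ[k] k[X]) (a : k[X]) : Type _ :=
  RingQuot (GWARel σ a)

/-- The classical automorphism `σ_cl` of `k[h]`, determined by `σ_cl(h) = h - 1`. -/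
noncomputable def sigmaCl (k : Type*) [Field k] : k[X] ≃ₐ[k] k[X] :=
  algEquivOfCompEqX (X - 1) (X + 1) (by simp) (by simp)

theorem sigmaCl_X (k : Type*) [Field k] : sigmaCl k X = X - 1 := by
  simp [sigmaCl]

end GWADefs

/-!
Reading `y` as `a(h) x⁻¹` embeds `k[h](σ_cl, a)` into `k[h, x, x⁻¹]` with the product twisted by
`x h = (h - 1) x`. For weights on `h` and `x`, the commutator has as leading form the Poisson
bracket, `{h, x} = x`, of the leading forms.

An isomorphism `φ : k[h](σ_cl, a) → k[h](σ_cl, b)` maps `x` to an ad-nilpotent element `z`, since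
`x` is ad-nilpotent. This confines the Newton polygon of `z` to a triangle over the `x`-axis and,
after possibly exchanging `x` and `y`, makes the leading form along its hypotenuse proportional to
`(h - r x ^ q) ^ m x ^ (-v)`, so that the triangular automorphism `h ↦ h + r x ^ q` shrinks the
polygon. By descent we may assume that `z` is a polynomial in `x`.

If `b` has degree at least `2`, comparing the centralizers of `x` and using `[φ x, φ h] = -φ x`
yields `φ x = c x` and `φ h = h + γ + w(x) x`. Reducing `a(φ h) = φ y * φ x` modulo the left ideal
of `x` gives `b ∣ a(h + γ)`, and the same argument for `φ⁻¹` makes the degrees equal.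
-/

section LocallyNilpotent

/-- A map `D` is nilpotent at `a` if some iterate of `D` kills `a`. -/
def IsNilAt {A : Type*} [Zero A] (D : A → A) (a : A) : Prop := ∃ m : ℕ, D^[m] a = 0

/-- `D^[m] a` is the last nonzero iterate of `D` at `a`. For a derivation of a domain of
characteristic zero, `m` behaves like the degree of a polynomial `a` under differentiation. -/
def HasNilDegree {A : Type*} [Zero A] (D : A → A) (a : A) (m : ℕ) : Prop :=
  D^[m] a ≠ 0 ∧ D^[m + 1] a = 0

theorem iterate_eq_zero_of_le {A F : Type*} [Zero A] [FunLike F A A] [ZeroHomClass F A A]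
    (D : F) {a : A} {m l : ℕ} (hml : m ≤ l) (ha : D^[m] a = 0) : D^[l] a = 0 := by
  obtain ⟨t, rfl⟩ := Nat.exists_eq_add_of_le' hml
  rw [Function.iterate_add_apply, ha, iterate_map_zero]

variable {k A : Type*} [CommRing k] [CommRing A] [Algebra k A] {D : Derivation k A A}
  {a b : A} {m l : ℕ}

theorem iterate_add_mul_of_iterate_succ_eq_zero (ha : D^[m + 1] a = 0) (hb : D^[l + 1] b = 0) :
    D^[m + l] (a * b) = (m + l).choose m • (D^[m] a * D^[l] b) := by
  induction hs : m + l generalizing m l a b with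
  | zero =>
    obtain ⟨rfl, rfl⟩ : m = 0 ∧ l = 0 := by omega
    simp
  | succ s ih =>
    rw [Function.iterate_succ_apply, D.leibniz, iterate_map_add, smul_eq_mul, smul_eq_mul,
      mul_comm b]
    rcases m with _ | m <;> rcases l with _ | l
    · omega
    · have h0 : D a = 0 := ha
      rw [h0, zero_mul, iterate_map_zero, add_zero, ih (b := D b) ha hb (by omega)]
      simp
    · have h0 : D b = 0 := hb
      obtain rfl : m = s := by omega
      rw [h0, mul_zero, iterate_map_zero, zero_add, ih (a := D a) ha hb (by omega)]
      simp
    · rw [ih (b := D b) (m := m + 1) ha hb (by omega), ih (a := D a) (l := l + 1) ha hb (by omega),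
        Nat.choose_succ_succ, add_smul, add_comm]
      rfl

theorem IsNilAt.mul (ha : IsNilAt D a) (hb : IsNilAt D b) : IsNilAt D (a * b) := by
  obtain ⟨m, hm⟩ := ha
  obtain ⟨l, hl⟩ := hb
  refine ⟨m + l + 1, ?_⟩
  rw [Function.iterate_succ_apply', iterate_add_mul_of_iterate_succ_eq_zero
    (iterate_eq_zero_of_le D m.le_succ hm) (iterate_eq_zero_of_le D l.le_succ hl), hm]
  simp

theorem IsNilAt.add (ha : IsNilAt D a) (hb : IsNilAt D b) : IsNilAt D (a + b) := by
  obtain ⟨m, hm⟩ := ha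
  obtain ⟨l, hl⟩ := hb
  refine ⟨m + l, ?_⟩
  rw [iterate_map_add, iterate_eq_zero_of_le D (by omega) hm,
    iterate_eq_zero_of_le D (by omega) hl, add_zero]

/-- The elements at which a derivation is nilpotent. -/
def nilSubalgebra (D : Derivation k A A) : Subalgebra k A where
  carrier := {a | IsNilAt D a}
  mul_mem' := IsNilAt.mul
  add_mem' := IsNilAt.add
  algebraMap_mem' r := ⟨1, D.map_algebraMap r⟩

theorem HasNilDegree.unique (h : HasNilDegree D a m) (h' : HasNilDegree D a l) : m = l := by
  by_contra hne
  rcases Nat.lt_or_gt_of_ne hne with hlt | hlt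
  · exact h'.1 (iterate_eq_zero_of_le D hlt h.2)
  · exact h.1 (iterate_eq_zero_of_le D hlt h'.2)

theorem IsNilAt.exists_hasNilDegree (h : IsNilAt D a) (ha : a ≠ 0) :
    ∃ m, HasNilDegree D a m := by
  classical
  obtain ⟨m, hm⟩ : ∃ m, Nat.find h = m + 1 := by
    refine Nat.exists_eq_succ_of_ne_zero fun h0 => ha ?_
    simpa only [h0, Function.iterate_zero, id_eq] using Nat.find_spec h
  exact ⟨m, Nat.find_min h (by omega), hm ▸ Nat.find_spec h⟩

theorem hasNilDegree_zero_iff : HasNilDegree D a 0 ↔ a ≠ 0 ∧ D a = 0 := Iff.rfl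

theorem HasNilDegree.ne_zero (h : HasNilDegree D a m) : a ≠ 0 := by
  rintro rfl
  exact h.1 (iterate_map_zero D m)

theorem HasNilDegree.apply (h : HasNilDegree D a (m + 1)) : HasNilDegree D (D a) m := h

theorem HasNilDegree.add_of_iterate_eq_zero (ha : HasNilDegree D a m) (hb : D^[m] b = 0) :
    HasNilDegree D (a + b) m := by
  refine ⟨?_, ?_⟩
  · rw [iterate_map_add, hb, add_zero]
    exact ha.1
  · rw [iterate_map_add, ha.2, iterate_eq_zero_of_le D m.le_succ hb, add_zero]

theorem hasNilDegree_one [Nontrivial A] : HasNilDegree D (1 : A) 0 :=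
  hasNilDegree_zero_iff.2 ⟨one_ne_zero, D.map_one_eq_zero⟩

section Domain

variable [IsDomain A] [CharZero A]

theorem HasNilDegree.mul (ha : HasNilDegree D a m) (hb : HasNilDegree D b l) :
    HasNilDegree D (a * b) (m + l) := by
  have key := iterate_add_mul_of_iterate_succ_eq_zero ha.2 hb.2
  refine ⟨?_, ?_⟩
  · rw [key]
    exact smul_ne_zero (Nat.choose_pos (by omega)).ne' (mul_ne_zero ha.1 hb.1)
  · rw [Function.iterate_succ_apply', key, map_nsmul, D.leibniz, ← Function.iterate_succ_apply' D,
      ← Function.iterate_succ_apply' D, ha.2, hb.2]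
    simp

theorem HasNilDegree.pow (ha : HasNilDegree D a m) (s : ℕ) : HasNilDegree D (a ^ s) (s * m) := by
  induction s with
  | zero => simpa using hasNilDegree_one
  | succ s ih =>
    rw [pow_succ, Nat.succ_mul]
    exact ih.mul ha

theorem apply_eq_zero_of_apply_mul_eq_zero (ha : IsNilAt D a) (hb : IsNilAt D b)
    (hab : a * b ≠ 0) (h : D (a * b) = 0) : D a = 0 ∧ D b = 0 := by
  obtain ⟨m, hm⟩ := ha.exists_hasNilDegree (left_ne_zero_of_mul hab)
  obtain ⟨l, hl⟩ := hb.exists_hasNilDegree (right_ne_zero_of_mul hab)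
  have := (hm.mul hl).unique (hasNilDegree_zero_iff.2 ⟨hab, h⟩)
  obtain ⟨rfl, rfl⟩ : m = 0 ∧ l = 0 := by omega
  exact ⟨(hasNilDegree_zero_iff.1 hm).2, (hasNilDegree_zero_iff.1 hl).2⟩

end Domain

end LocallyNilpotent

/-- The commutative ring `k[h, x, x⁻¹]` in which the symbols of elements of a generalized Weyl
algebra live; the pair `(i, l)` stands for the monomial `h ^ i * x ^ l`. -/
abbrev SymbolRing (k : Type*) [Field k] := AddMonoidAlgebra k (ℕ × ℤ)

namespace SymbolRing

variable {k : Type*} [Field k]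

section Monomials

/-- The monomial `h ^ i * x ^ l`. -/
noncomputable def mon (i : ℕ) (l : ℤ) : SymbolRing k := AddMonoidAlgebra.single (i, l) 1

theorem mon_mul_mon (i i' : ℕ) (l l' : ℤ) :
    (mon i l * mon i' l' : SymbolRing k) = mon (i + i') (l + l') := by
  simp [mon, AddMonoidAlgebra.single_mul_single]

theorem mon_zero_zero : (mon 0 0 : SymbolRing k) = 1 := rfl

theorem mon_pow (i : ℕ) (l : ℤ) (s : ℕ) : (mon i l : SymbolRing k) ^ s = mon (s * i) (s * l) := by
  simp [mon, AddMonoidAlgebra.single_pow]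

theorem mon_eq_pow_mul (i : ℕ) (l : ℤ) : (mon i l : SymbolRing k) = mon 1 0 ^ i * mon 0 l := by
  simp [mon_pow, mon_mul_mon]

theorem mon_zero_add (l l' : ℤ) : (mon 0 (l + l') : SymbolRing k) = mon 0 l * mon 0 l' := by
  rw [mon_mul_mon, zero_add]

theorem mon_ne_zero (i : ℕ) (l : ℤ) : (mon i l : SymbolRing k) ≠ 0 := by
  simp [mon]

theorem coeff_mon (i i' : ℕ) (l l' : ℤ) :
    (mon i l : SymbolRing k).coeff (i', l') = if i = i' ∧ l = l' then 1 else 0 := by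
  classical
  simp only [mon, AddMonoidAlgebra.coeff_single, Finsupp.single_apply, Prod.mk.injEq]

variable {N : Type*} [AddCommGroup N] [Module k N]

/-- The linear map with prescribed values on monomials. -/
noncomputable def linOfMon (φ : ℕ → ℤ → N) : SymbolRing k →ₗ[k] N :=
  (AddMonoidAlgebra.basis (ℕ × ℤ) k).constr k fun m => φ m.1 m.2

theorem linOfMon_mon (φ : ℕ → ℤ → N) (i : ℕ) (l : ℤ) : linOfMon (k := k) φ (mon i l) = φ i l := by
  simpa [linOfMon, mon] using
    (AddMonoidAlgebra.basis (ℕ × ℤ) k).constr_basis k (fun m => φ m.1 m.2) (i, l)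

theorem linearMap_ext {S T : SymbolRing k →ₗ[k] N} (h : ∀ i l, S (mon i l) = T (mon i l)) :
    S = T :=
  (AddMonoidAlgebra.basis (ℕ × ℤ) k).ext fun m => by simpa [mon] using h m.1 m.2

theorem algHom_ext {S T : SymbolRing k →ₐ[k] SymbolRing k} (h : S (mon 1 0) = T (mon 1 0))
    (h' : ∀ l, S (mon 0 l) = T (mon 0 l)) : S = T := by
  refine AlgHom.toLinearMap_injective (linearMap_ext fun i l => ?_)
  rw [mon_eq_pow_mul]
  simp [h, h']

end Monomials

section Support

/-- Elements all of whose monomials `h ^ i * x ^ l` satisfy `P i l`. -/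
noncomputable def supp (P : ℕ → ℤ → Prop) : Submodule k (SymbolRing k) :=
  AddMonoidAlgebra.supported k k {m | P m.1 m.2}

variable {P Q R : ℕ → ℤ → Prop} {f g : SymbolRing k}

theorem mem_supp : f ∈ supp P ↔ ∀ i l, f.coeff (i, l) ≠ 0 → P i l := by
  rw [supp, AddMonoidAlgebra.mem_supported']
  simp [not_imp_comm]

theorem mon_mem_supp {i : ℕ} {l : ℤ} (h : P i l) : (mon i l : SymbolRing k) ∈ supp P := by
  rw [mem_supp]
  intro i' l' h'
  rw [coeff_mon] at h'
  obtain ⟨rfl, rfl⟩ : i = i' ∧ l = l' := by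
    by_contra hc
    exact h' (if_neg hc)
  exact h

theorem exists_mem_supp_neg_le_le (f : SymbolRing k) :
    ∃ m : ℕ, f ∈ supp fun _ l => -m ≤ l ∧ l ≤ m := by
  refine ⟨f.coeff.support.sup fun t => t.2.natAbs, mem_supp.2 fun i l hil => ?_⟩
  have := Finset.le_sup (f := fun t : ℕ × ℤ => t.2.natAbs) (Finsupp.mem_support_iff.2 hil)
  dsimp only at this
  omega

theorem supp_mono (h : ∀ i l, P i l → Q i l) : (supp P : Submodule k (SymbolRing k)) ≤ supp Q :=
  fun _ hf => mem_supp.2 fun i l hil => h i l (mem_supp.1 hf i l hil)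

theorem map_mem_of_mem_supp {N : Type*} [AddCommGroup N] [Module k N] (T : SymbolRing k →ₗ[k] N)
    {M : Submodule k N} (h : ∀ i l, P i l → T (mon i l) ∈ M) (hf : f ∈ supp P) : T f ∈ M := by
  have : supp P ≤ M.comap T := by
    rw [supp, AddMonoidAlgebra.supported_eq_span_single, Submodule.span_le]
    rintro _ ⟨m, hm, rfl⟩
    exact h m.1 m.2 hm
  exact this hf

theorem mul_mem_supp (h : ∀ i l i' l', P i l → Q i' l' → R (i + i') (l + l')) (hf : f ∈ supp P)
    (hg : g ∈ supp Q) : f * g ∈ supp R := by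
  refine map_mem_of_mem_supp (LinearMap.mulRight k g) (fun i l hil => ?_) hf
  refine map_mem_of_mem_supp (LinearMap.mulLeft k (mon i l)) (fun i' l' hil' => ?_) hg
  rw [LinearMap.mulLeft_apply, mon_mul_mon]
  exact mon_mem_supp (h i l i' l' hil hil')

end Support

section Slice

/-- The coefficient of `x ^ l`, a polynomial in `h`. -/
noncomputable def slice (l : ℤ) : SymbolRing k →ₗ[k] k[X] :=
  linOfMon fun i l' => if l' = l then X ^ i else 0

theorem coeff_slice (l : ℤ) (f : SymbolRing k) (i : ℕ) :
    (slice l f).coeff i = f.coeff (i, l) := by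
  have : lcoeff k i ∘ₗ slice l =
      Finsupp.lapply (i, l) ∘ₗ (AddMonoidAlgebra.coeffLinearEquiv k).toLinearMap := by
    refine linearMap_ext fun i' l' => ?_
    simp only [LinearMap.comp_apply, slice, linOfMon_mon, lcoeff_apply]
    change _ = (mon i' l' : SymbolRing k).coeff (i, l)
    rw [coeff_mon]
    by_cases h : l' = l
    · simp [h, coeff_X_pow, eq_comm]
    · simp [h]
  exact LinearMap.congr_fun this f

theorem slice_aeval_mul_mon (r : k[X]) (l l' : ℤ) :
    slice l (aeval (mon 1 0) r * mon 0 l' : SymbolRing k) = if l' = l then r else 0 := by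
  induction r using Polynomial.induction_on' with
  | add P Q hP hQ =>
    simp only [map_add, add_mul, hP, hQ]
    split_ifs <;> simp
  | monomial s c =>
    rw [aeval_monomial, ← Algebra.smul_def, smul_mul_assoc, ← mon_eq_pow_mul, map_smul, slice,
      linOfMon_mon]
    split_ifs <;> simp [smul_eq_C_mul, C_mul_X_pow_eq_monomial]

theorem ext_slice {f g : SymbolRing k} (h : ∀ l, slice l f = slice l g) : f = g := by
  ext ⟨i, l⟩
  rw [← coeff_slice, h, coeff_slice]

theorem mem_supp_iff_slice {P : ℤ → Prop} {f : SymbolRing k} :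
    f ∈ supp (fun _ l => P l) ↔ ∀ l, slice l f ≠ 0 → P l := by
  rw [mem_supp, forall_comm]
  refine forall_congr' fun l => ?_
  simp only [Ne, Polynomial.ext_iff, coeff_slice, coeff_zero, not_forall, forall_exists_index]

end Slice

section Bracket

theorem leibniz_of_mon {T : SymbolRing k →ₗ[k] SymbolRing k}
    (h : ∀ i l i' l', T (mon i l * mon i' l') = mon i l * T (mon i' l') + mon i' l' * T (mon i l))
    (f g : SymbolRing k) : T (f * g) = f • T g + g • T f := by
  let B := (LinearMap.mul k (SymbolRing k)).compl₂ T
  have : (LinearMap.mul k (SymbolRing k)).compr₂ T = B + B.flip :=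
    linearMap_ext fun i l => linearMap_ext fun i' l' => h i l i' l'
  exact LinearMap.congr_fun (LinearMap.congr_fun this f) g

/-- The derivation `∂/∂h`. -/
noncomputable def dh : Derivation k (SymbolRing k) (SymbolRing k) :=
  Derivation.mk' (linOfMon fun i l => (i : k) • mon (i - 1) l) <|
    leibniz_of_mon fun i l i' l' => by
      simp only [mon_mul_mon, linOfMon_mon, mul_smul_comm]
      rcases i with _ | i <;> rcases i' with _ | i'
      · simp
      · simp
      · simp [add_comm]
      · have e1 : i + 1 + (i' + 1) - 1 = i + i' + 1 := by omega
        have e2 : i + 1 + (i' + 1 - 1) = i + i' + 1 := by omega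
        have e3 : i' + 1 + (i + 1 - 1) = i + i' + 1 := by omega
        rw [e1, e2, e3, add_comm l' l, ← add_smul]
        push_cast
        congr 1
        ring

/-- The Euler derivation `x ∂/∂x`. -/
noncomputable def xdx : Derivation k (SymbolRing k) (SymbolRing k) :=
  Derivation.mk' (linOfMon fun i l => (l : k) • mon i l) <| leibniz_of_mon fun i l i' l' => by
    simp only [mon_mul_mon, linOfMon_mon, mul_smul_comm]
    rw [add_comm l' l, add_comm i' i, ← add_smul]
    push_cast
    congr 1
    ring

theorem dh_mon (i : ℕ) (l : ℤ) : dh (mon i l : SymbolRing k) = (i : k) • mon (i - 1) l := by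
  rw [dh, Derivation.coe_mk', linOfMon_mon]

theorem xdx_mon (i : ℕ) (l : ℤ) : xdx (mon i l : SymbolRing k) = (l : k) • mon i l := by
  rw [xdx, Derivation.coe_mk', linOfMon_mon]

/-- The Poisson bracket `{f, ·}` with `{h, x} = x`, the classical limit of the commutator. -/
noncomputable def bracket (f : SymbolRing k) : Derivation k (SymbolRing k) (SymbolRing k) :=
  dh f • xdx - xdx f • dh

theorem bracket_apply (f g : SymbolRing k) : bracket f g = dh f * xdx g - xdx f * dh g := rfl

theorem bracket_self (f : SymbolRing k) : bracket f f = 0 := by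
  rw [bracket_apply]; ring

theorem bracket_x (f : SymbolRing k) : bracket f (mon 0 1) = dh f * mon 0 1 := by
  simp [bracket_apply, dh_mon, xdx_mon]

theorem bracket_h (f : SymbolRing k) : bracket f (mon 1 0) = -xdx f := by
  simp [bracket_apply, dh_mon, xdx_mon, mon_zero_zero]

variable {P Q : ℕ → ℤ → Prop} {f : SymbolRing k}

theorem dh_mem_supp (h : ∀ i l, P (i + 1) l → Q i l) (hf : f ∈ supp P) : dh f ∈ supp Q := by
  refine map_mem_of_mem_supp dh.toLinearMap (fun i l hil => ?_) hf
  change dh (mon i l) ∈ _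
  rw [dh_mon]
  rcases i with _ | i
  · simp
  · exact Submodule.smul_mem _ _ (mon_mem_supp (h i l hil))

theorem xdx_mem_supp (hf : f ∈ supp P) : xdx f ∈ supp P := by
  refine map_mem_of_mem_supp xdx.toLinearMap (fun i l hil => ?_) hf
  change xdx (mon i l) ∈ _
  rw [xdx_mon]
  exact Submodule.smul_mem _ _ (mon_mem_supp hil)

end Bracket

section Star

/-- The endomorphism `h ↦ h + g`, `x ↦ x`. -/
noncomputable def translateH (g : SymbolRing k) : SymbolRing k →ₐ[k] SymbolRing k :=
  AddMonoidAlgebra.lift k (SymbolRing k) (ℕ × ℤ)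
    { toFun := fun m => (mon 1 0 + g) ^ m.toAdd.1 * mon 0 m.toAdd.2
      map_one' := by simp [mon_zero_zero]
      map_mul' := fun m m' => by
        simp only [toAdd_mul, Prod.fst_add, Prod.snd_add, pow_add]
        rw [← zero_add (0 : ℕ), ← mon_mul_mon, zero_add]
        ring }

theorem translateH_mon (g : SymbolRing k) (i : ℕ) (l : ℤ) :
    translateH g (mon i l) = (mon 1 0 + g) ^ i * mon 0 l :=
  (AddMonoidAlgebra.lift_single _ _ _).trans (by simp)

/-- The shift `h ↦ h - c`, `x ↦ x`. -/
noncomputable def shift (c : k) : SymbolRing k →ₐ[k] SymbolRing k :=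
  translateH (-algebraMap k _ c)

theorem shift_mon (c : k) (i : ℕ) (l : ℤ) :
    shift c (mon i l) = (mon 1 0 - algebraMap k _ c) ^ i * mon 0 l := by
  rw [shift, translateH_mon, sub_eq_add_neg]

theorem shift_mon_zero (c : k) (l : ℤ) : shift c (mon 0 l) = mon 0 l := by
  simp [shift_mon]

theorem shift_h (c : k) : shift c (mon 1 0) = mon 1 0 - algebraMap k _ c := by
  simp [shift_mon, mon_zero_zero]

theorem shift_shift (c d : k) (f : SymbolRing k) : shift c (shift d f) = shift (c + d) f := by
  suffices (shift c).comp (shift d) = shift (c + d) from DFunLike.congr_fun this f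
  refine algHom_ext ?_ fun l => by simp [shift_mon_zero]
  simp only [AlgHom.comp_apply, shift_h, map_sub, AlgHom.commutes, map_add]
  ring

theorem shift_zero (f : SymbolRing k) : shift 0 f = f := by
  suffices shift (0 : k) = AlgHom.id k _ from DFunLike.congr_fun this f
  exact algHom_ext (by simp [shift_h]) fun l => by simp [shift_mon_zero]

theorem shift_aeval (c : k) (r : k[X]) :
    shift c (aeval (mon 1 0) r) = aeval (mon 1 0) (r.comp (X - C c)) := by
  rw [← aeval_algHom_apply, shift_h, aeval_comp]
  simp

/-- The noncommutative product of symbols induced by the rule `x * g(h) = g(h - 1) * x`. -/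
noncomputable def starMul : SymbolRing k →ₗ[k] SymbolRing k →ₗ[k] SymbolRing k :=
  linOfMon fun i l => LinearMap.mulLeft k (mon i l) ∘ₗ (shift (l : k)).toLinearMap

theorem starMul_mon (i : ℕ) (l : ℤ) (g : SymbolRing k) :
    starMul (mon i l) g = mon i l * shift (l : k) g := by
  rw [starMul, linOfMon_mon]; rfl

theorem one_starMul (g : SymbolRing k) : starMul 1 g = g := by
  rw [← mon_zero_zero, starMul_mon, mon_zero_zero, one_mul, Int.cast_zero, shift_zero]

theorem starMul_mon_zero (f : SymbolRing k) (l : ℤ) : starMul f (mon 0 l) = f * mon 0 l := by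
  suffices starMul.flip (mon 0 l) = LinearMap.mulRight k (mon 0 l) from LinearMap.congr_fun this f
  refine linearMap_ext fun i l' => ?_
  rw [LinearMap.flip_apply, starMul_mon, shift_mon_zero, LinearMap.mulRight_apply]

theorem starMul_one (f : SymbolRing k) : starMul f 1 = f := by
  rw [← mon_zero_zero, starMul_mon_zero, mon_zero_zero, mul_one]

theorem starMul_aeval_mul (r : k[X]) (f g : SymbolRing k) :
    starMul (aeval (mon 1 0) r * f) g = aeval (mon 1 0) r * starMul f g := by
  induction r using Polynomial.induction_on' with
  | add P Q hP hQ => rw [map_add, add_mul, map_add, LinearMap.add_apply, hP, hQ, add_mul]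
  | monomial s c =>
    suffices starMul.flip g ∘ₗ LinearMap.mulLeft k (mon s 0) =
        LinearMap.mulLeft k (mon s 0) ∘ₗ starMul.flip g by
      have := LinearMap.congr_fun this f
      simp only [LinearMap.comp_apply, LinearMap.mulLeft_apply, LinearMap.flip_apply] at this
      rw [aeval_monomial, ← Algebra.smul_def, mon_pow, mul_one, mul_zero, smul_mul_assoc, map_smul,
        LinearMap.smul_apply, this, smul_mul_assoc]
    refine linearMap_ext fun i l => ?_
    simp only [LinearMap.comp_apply, LinearMap.mulLeft_apply, LinearMap.flip_apply, mon_mul_mon,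
      starMul_mon, ← mul_assoc, zero_add]

theorem aeval_starMul (r : k[X]) (g : SymbolRing k) :
    starMul (aeval (mon 1 0) r) g = aeval (mon 1 0) r * g := by
  simpa only [mul_one, one_starMul] using starMul_aeval_mul r 1 g

theorem starMul_assoc (f g e : SymbolRing k) :
    starMul (starMul f g) e = starMul f (starMul g e) := by
  suffices starMul.compr₂ (starMul.flip e) = starMul.compl₂ (starMul.flip e) from
    LinearMap.congr_fun (LinearMap.congr_fun this f) g
  refine linearMap_ext fun i l => linearMap_ext fun i' l' => ?_
  change starMul (starMul (mon i l) (mon i' l')) e = starMul (mon i l) (starMul (mon i' l') e)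
  have hmon : starMul (mon i l : SymbolRing k) (mon i' l') =
      aeval (mon 1 0) (X ^ i * (X - C (l : k)) ^ i') * mon 0 (l + l') := by
    rw [starMul_mon, shift_mon, mon_eq_pow_mul i l, mon_zero_add]
    simp only [map_mul, map_pow, map_sub, aeval_X, aeval_C]
    ring
  rw [hmon, starMul_aeval_mul, starMul_mon, starMul_mon, starMul_mon, map_mul (shift _),
    shift_shift, shift_mon, Int.cast_add, mon_eq_pow_mul i l, mon_zero_add]
  simp only [map_mul, map_pow, map_sub, aeval_X, aeval_C]
  ring

end Star

end SymbolRing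

namespace SymbolRing

variable {k : Type*} [Field k] {q p W V : ℤ} {f f₀ g g₀ : SymbolRing k}

section Weights

/-- Elements whose monomials have weight at most `W`, where `h` has weight `q` and `x` has
weight `p`. -/
noncomputable def weightLE (k : Type*) [Field k] (q p W : ℤ) : Submodule k (SymbolRing k) :=
  supp fun i l => q * i + p * l ≤ W

/-- Elements whose monomials all have weight `W`, where `h` has weight `q` and `x` has
weight `p`. -/
noncomputable def weightEq (k : Type*) [Field k] (q p W : ℤ) : Submodule k (SymbolRing k) :=
  supp fun i l => q * i + p * l = W

theorem weightLE_mono (h : W ≤ V) : weightLE k q p W ≤ weightLE k q p V :=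
  supp_mono fun _ _ => (·.trans h)

theorem weightEq_le_weightLE : weightEq k q p W ≤ weightLE k q p W :=
  supp_mono fun _ _ => le_of_eq

theorem eq_zero_of_mem_weightEq_of_mem_weightLE (h : f ∈ weightEq k q p W)
    (h' : f ∈ weightLE k q p (W - 1)) : f = 0 := by
  ext ⟨i, l⟩
  by_contra hne
  have h1 := mem_supp.1 h i l hne
  have h2 := mem_supp.1 h' i l hne
  omega

theorem mul_mem_weightLE (hf : f ∈ weightLE k q p W) (hg : g ∈ weightLE k q p V) :
    f * g ∈ weightLE k q p (W + V) :=
  mul_mem_supp (fun i l i' l' h h' => by push_cast; linarith) hf hg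

theorem mul_mem_weightEq (hf : f ∈ weightEq k q p W) (hg : g ∈ weightEq k q p V) :
    f * g ∈ weightEq k q p (W + V) :=
  mul_mem_supp (fun i l i' l' h h' => by push_cast; linarith) hf hg

theorem dh_mem_weightLE (hf : f ∈ weightLE k q p W) : dh f ∈ weightLE k q p (W - q) :=
  dh_mem_supp (fun i l h => by push_cast at h; linarith) hf

theorem dh_mem_weightEq (hf : f ∈ weightEq k q p W) : dh f ∈ weightEq k q p (W - q) :=
  dh_mem_supp (fun i l h => by push_cast at h; linarith) hf

theorem bracket_mem_weightLE (hf : f ∈ weightLE k q p W) (hg : g ∈ weightLE k q p V) :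
    bracket f g ∈ weightLE k q p (W + V - q) := by
  have h1 := mul_mem_weightLE (dh_mem_weightLE hf) (xdx_mem_supp hg)
  have h2 := mul_mem_weightLE (xdx_mem_supp hf) (dh_mem_weightLE hg)
  rw [sub_add_eq_add_sub] at h1
  rw [← add_sub_assoc] at h2
  exact sub_mem h1 h2

theorem bracket_mem_weightEq (hf : f ∈ weightEq k q p W) (hg : g ∈ weightEq k q p V) :
    bracket f g ∈ weightEq k q p (W + V - q) := by
  have h1 := mul_mem_weightEq (dh_mem_weightEq hf) (xdx_mem_supp hg)
  have h2 := mul_mem_weightEq (xdx_mem_supp hf) (dh_mem_weightEq hg)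
  rw [sub_add_eq_add_sub] at h1
  rw [← add_sub_assoc] at h2
  exact sub_mem h1 h2

end Weights

section Expansion

theorem shift_pow_sub_add_mem_supp (c : k) (i : ℕ) :
    (mon 1 0 - algebraMap k _ c) ^ i - mon i 0 + c • dh (mon i 0) ∈
      (supp fun i' l' => i' + 2 ≤ i ∧ l' = 0 : Submodule k (SymbolRing k)) := by
  induction i with
  | zero => simp [mon_zero_zero]
  | succ i ih =>
    have hu : (mon 1 0 - algebraMap k _ c : SymbolRing k) ∈ supp fun i' l' => i' ≤ 1 ∧ l' = 0 := by
      refine sub_mem (mon_mem_supp ⟨le_rfl, rfl⟩) ?_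
      rw [Algebra.algebraMap_eq_smul_one, ← mon_zero_zero]
      exact Submodule.smul_mem _ _ (mon_mem_supp ⟨zero_le_one, rfl⟩)
    have hstep : (mon 1 0 - algebraMap k _ c) ^ (i + 1) - mon (i + 1) 0 + c • dh (mon (i + 1) 0) =
        (mon 1 0 - algebraMap k _ c) *
          ((mon 1 0 - algebraMap k _ c) ^ i - mon i 0 + c • dh (mon i 0)) +
            c ^ 2 • dh (mon i 0 : SymbolRing k) := by
      have hmon : (mon (i + 1) 0 : SymbolRing k) = mon 1 0 * mon i 0 := by
        rw [mon_mul_mon, add_comm, zero_add]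
      have hdh : dh (mon 1 0 : SymbolRing k) = 1 := by simp [dh_mon, mon_zero_zero]
      rw [hmon, Derivation.leibniz, hdh]
      simp only [Algebra.smul_def, map_pow, Algebra.algebraMap_self_apply]
      ring
    rw [hstep]
    refine add_mem (mul_mem_supp (fun _ _ _ _ h h' => ?_) hu ih) (Submodule.smul_mem _ _ ?_)
    · omega
    · refine dh_mem_supp (P := fun i' l' => i' = i ∧ l' = 0) (fun _ _ h => ?_)
        (mon_mem_supp ⟨rfl, rfl⟩)
      omega

theorem shift_sub_add_mem_weightLE (c : k) (hg : g ∈ weightLE k q p V) (hq : 0 ≤ q) :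
    shift c g - g + c • dh g ∈ weightLE k q p (V - 2 * q) := by
  refine map_mem_of_mem_supp ((shift c).toLinearMap - LinearMap.id + c • dh.toLinearMap)
    (fun i l hil => ?_) hg
  change shift c (mon i l) - mon i l + c • dh (mon i l) ∈ _
  have hfactor : shift c (mon i l) - mon i l + c • dh (mon i l) =
      ((mon 1 0 - algebraMap k _ c) ^ i - mon i 0 + c • dh (mon i 0)) * mon 0 l := by
    rw [shift_mon, dh_mon, dh_mon, add_mul, sub_mul, smul_mul_assoc, smul_mul_assoc, mon_mul_mon,
      mon_mul_mon]
    simp only [add_zero, zero_add]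
  rw [hfactor]
  refine mul_mem_supp (fun i₁ l₁ i₂ l₂ h₁ h₂ => ?_) (shift_pow_sub_add_mem_supp c i)
    (mon_mem_supp (P := fun i' l' => i' = 0 ∧ l' = l) ⟨rfl, rfl⟩)
  obtain ⟨h₁, rfl⟩ := h₁
  obtain ⟨rfl, rfl⟩ := h₂
  have : (i₁ : ℤ) + 2 ≤ i := by exact_mod_cast h₁
  push_cast
  nlinarith

theorem starMul_sub_mul_add_mem_weightLE (hf : f ∈ weightLE k q p W) (hg : g ∈ weightLE k q p V)
    (hq : 0 ≤ q) : starMul f g - f * g + xdx f * dh g ∈ weightLE k q p (W + V - 2 * q) := by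
  refine map_mem_of_mem_supp (starMul.flip g - LinearMap.mulRight k g +
    LinearMap.mulRight k (dh g) ∘ₗ xdx.toLinearMap) (fun i l hil => ?_) hf
  change starMul (mon i l) g - mon i l * g + xdx (mon i l) * dh g ∈ _
  have hfactor : starMul (mon i l) g - mon i l * g + xdx (mon i l) * dh g =
      mon i l * (shift (l : k) g - g + (l : k) • dh g) := by
    rw [starMul_mon, xdx_mon, smul_mul_assoc, mul_add, mul_sub, mul_smul_comm]
  rw [hfactor, add_sub_assoc]
  exact mul_mem_weightLE (mon_mem_supp hil) (shift_sub_add_mem_weightLE _ hg hq)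

end Expansion

section LeadingForm

/-- `f₀` is the part of weight `W` of `f`, and `f` has no part of higher weight. We allow
`f₀ = 0`, which makes the notion stable under products and brackets. -/
structure HasLeadingForm (q p W : ℤ) (f f₀ : SymbolRing k) : Prop where
  mem_weightEq : f₀ ∈ weightEq k q p W
  sub_mem_weightLE : f - f₀ ∈ weightLE k q p (W - 1)

theorem hasLeadingForm_self (hf : f ∈ weightEq k q p W) : HasLeadingForm q p W f f :=
  ⟨hf, by rw [sub_self]; exact zero_mem _⟩

theorem HasLeadingForm.mem_weightLE (hf : HasLeadingForm q p W f f₀) : f ∈ weightLE k q p W := by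
  rw [← sub_add_cancel f f₀]
  exact add_mem (weightLE_mono (by omega) hf.sub_mem_weightLE)
    (weightEq_le_weightLE hf.mem_weightEq)

theorem HasLeadingForm.eq_zero (h : HasLeadingForm q p W 0 f₀) : f₀ = 0 :=
  eq_zero_of_mem_weightEq_of_mem_weightLE h.mem_weightEq
    (by simpa using neg_mem h.sub_mem_weightLE)

theorem hasLeadingForm_starMul (hf : HasLeadingForm q p W f f₀) (hg : HasLeadingForm q p V g g₀)
    (hq : 0 < q) : HasLeadingForm q p (W + V) (starMul f g) (f₀ * g₀) := by
  refine ⟨mul_mem_weightEq hf.mem_weightEq hg.mem_weightEq, ?_⟩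
  have h1 := starMul_sub_mul_add_mem_weightLE hf.mem_weightLE hg.mem_weightLE hq.le
  have h2 := mul_mem_weightLE (xdx_mem_supp hf.mem_weightLE) (dh_mem_weightLE hg.mem_weightLE)
  have h3 := mul_mem_weightLE hf.sub_mem_weightLE hg.mem_weightLE
  have h4 := mul_mem_weightLE (weightEq_le_weightLE hf.mem_weightEq) hg.sub_mem_weightLE
  have := add_mem (add_mem (sub_mem (weightLE_mono (V := W + V - 1) (by omega) h1)
    (weightLE_mono (by omega) h2)) (weightLE_mono (by omega) h3)) (weightLE_mono (by omega) h4)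
  convert this using 1
  ring

theorem hasLeadingForm_starMul_sub_starMul (hf : HasLeadingForm q p W f f₀)
    (hg : HasLeadingForm q p V g g₀) (hq : 0 < q) :
    HasLeadingForm q p (W + V - q) (starMul f g - starMul g f) (bracket f₀ g₀) := by
  refine ⟨bracket_mem_weightEq hf.mem_weightEq hg.mem_weightEq, ?_⟩
  have h1 := starMul_sub_mul_add_mem_weightLE hf.mem_weightLE hg.mem_weightLE hq.le
  have h2 := starMul_sub_mul_add_mem_weightLE hg.mem_weightLE hf.mem_weightLE hq.le
  have h3 := bracket_mem_weightLE hf.sub_mem_weightLE hg.mem_weightLE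
  have h4 := bracket_mem_weightLE (weightEq_le_weightLE hf.mem_weightEq) hg.sub_mem_weightLE
  have := add_mem (add_mem (sub_mem (weightLE_mono (V := W + V - q - 1) (by omega) h1)
    (weightLE_mono (by omega) h2)) (weightLE_mono (by omega) h3)) (weightLE_mono (by omega) h4)
  convert this using 1
  simp only [bracket_apply, map_sub]
  ring

/-- The part of weight `W`, where `h` has weight `q` and `x` has weight `p`. -/
noncomputable def topPart (q p W : ℤ) (f : SymbolRing k) : SymbolRing k :=
  .ofCoeff (f.coeff.filter fun m => q * m.1 + p * m.2 = W)

theorem coeff_topPart (f : SymbolRing k) (i : ℕ) (l : ℤ) :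
    (topPart q p W f).coeff (i, l) = if q * i + p * l = W then f.coeff (i, l) else 0 :=
  Finsupp.filter_apply ..

theorem hasLeadingForm_topPart (hf : f ∈ weightLE k q p W) :
    HasLeadingForm q p W f (topPart q p W f) := by
  refine ⟨mem_supp.2 fun i l h => ?_, mem_supp.2 fun i l h => ?_⟩
  · rw [coeff_topPart] at h
    exact (ite_ne_right_iff.1 h).1
  · rw [AddMonoidAlgebra.coeff_sub, Finsupp.sub_apply, coeff_topPart] at h
    split_ifs at h with hW
    · exact absurd (sub_self _) h
    · rw [sub_zero] at h
      have := mem_supp.1 hf i l h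
      omega

end LeadingForm

end SymbolRing

/-- The generalized Weyl algebra `k[h](σ_cl, a)`. -/
abbrev ClassicalGWA {k : Type*} [Field k] (a : k[X]) := GWA (sigmaCl k) a

theorem mul_aeval_of_mul_eq {k S : Type*} [CommSemiring k] [Semiring S] [Algebra k S] {u b c : S}
    (h : u * b = c * u) (r : k[X]) : u * aeval b r = aeval c r * u := by
  induction r using Polynomial.induction_on' with
  | add P Q hP hQ => simp only [map_add, mul_add, add_mul, hP, hQ]
  | monomial s t =>
    have hs : u * b ^ s = c ^ s * u := SemiconjBy.pow_right h s
    rw [aeval_monomial, aeval_monomial, mul_assoc, ← hs, ← mul_assoc, ← mul_assoc,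
      Algebra.commutes]

theorem sigmaCl_apply {k : Type*} [Field k] (r : k[X]) : sigmaCl k r = r.comp (X - 1) := by
  rw [sigmaCl, algEquivOfCompEqX_apply, comp_eq_aeval]

theorem sigmaCl_symm_X {k : Type*} [Field k] : (sigmaCl k).symm X = X + 1 := by
  rw [AlgEquiv.symm_apply_eq, sigmaCl_apply]
  simp

namespace ClassicalGWA

variable {k : Type*} [Field k] (a : k[X])

section Generators

/-- The generator `h`. -/
noncomputable def genH : ClassicalGWA a :=
  RingQuot.mkAlgHom k _ (FreeAlgebra.ι k GWAGen.h)

/-- The generator `x`. -/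
noncomputable def genX : ClassicalGWA a :=
  RingQuot.mkAlgHom k _ (FreeAlgebra.ι k GWAGen.x)

/-- The generator `y`. -/
noncomputable def genY : ClassicalGWA a :=
  RingQuot.mkAlgHom k _ (FreeAlgebra.ι k GWAGen.y)

theorem mkAlgHom_poly (r : k[X]) :
    RingQuot.mkAlgHom k (GWARel (sigmaCl k) a) (GWAGen.poly r) = aeval (genH a) r := by
  rw [GWAGen.poly, ← aeval_algHom_apply]; rfl

theorem genX_mul_genH : genX a * genH a = (genH a - 1) * genX a := by
  have := RingQuot.mkAlgHom_rel k (GWARel.x_h (σ := sigmaCl k) (a := a))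
  rw [map_mul, map_mul, mkAlgHom_poly, sigmaCl_X, map_sub, map_one, aeval_X] at this
  exact this

theorem genY_mul_genH : genY a * genH a = (genH a + 1) * genY a := by
  have := RingQuot.mkAlgHom_rel k (GWARel.y_h (σ := sigmaCl k) (a := a))
  rw [map_mul, map_mul, mkAlgHom_poly, sigmaCl_symm_X, map_add, map_one, aeval_X] at this
  exact this

theorem genX_mul_genY : genX a * genY a = aeval (genH a - 1) a := by
  have := RingQuot.mkAlgHom_rel k (GWARel.x_y (σ := sigmaCl k) (a := a))
  rw [map_mul, mkAlgHom_poly, sigmaCl_apply, aeval_comp, map_sub, map_one, aeval_X] at this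
  exact this

theorem genY_mul_genX : genY a * genX a = aeval (genH a) a := by
  have := RingQuot.mkAlgHom_rel k (GWARel.y_x (σ := sigmaCl k) (a := a))
  rwa [map_mul, mkAlgHom_poly] at this

variable {a}

theorem adjoin_generators : Algebra.adjoin k {genH a, genX a, genY a} = ⊤ := by
  rw [eq_top_iff]
  rintro b -
  obtain ⟨c, rfl⟩ := RingQuot.mkAlgHom_surjective k _ b
  induction c using FreeAlgebra.induction with
  | grade0 r => rw [AlgHom.commutes]; exact Subalgebra.algebraMap_mem _ r
  | grade1 g => cases g <;> exact Algebra.subset_adjoin (by simp [genH, genX, genY])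
  | mul b c hb hc => rw [map_mul]; exact mul_mem hb hc
  | add b c hb hc => rw [map_add]; exact add_mem hb hc

theorem algHom_ext {S : Type*} [Ring S] [Algebra k S] {F G : ClassicalGWA a →ₐ[k] S}
    (hH : F (genH a) = G (genH a)) (hX : F (genX a) = G (genX a))
    (hY : F (genY a) = G (genY a)) : F = G := by
  refine AlgHom.ext_of_adjoin_eq_top adjoin_generators ?_
  rintro b (rfl | rfl | rfl) <;> assumption

theorem submodule_eq_top {M : Submodule k (ClassicalGWA a)} (h1 : 1 ∈ M)
    (hH : ∀ b ∈ M, genH a * b ∈ M) (hX : ∀ b ∈ M, genX a * b ∈ M)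
    (hY : ∀ b ∈ M, genY a * b ∈ M) : M = ⊤ := by
  let T : Subalgebra k (ClassicalGWA a) :=
    { carrier := {c | ∀ b ∈ M, c * b ∈ M}
      mul_mem' := fun {c d} hc hd b hb => by rw [mul_assoc]; exact hc _ (hd b hb)
      add_mem' := fun {c d} hc hd b hb => by rw [add_mul]; exact add_mem (hc b hb) (hd b hb)
      algebraMap_mem' := fun r b hb => by rw [← Algebra.smul_def]; exact M.smul_mem r hb }
  have hT : T = ⊤ := by
    rw [eq_top_iff, ← adjoin_generators, Algebra.adjoin_le_iff]
    rintro b (rfl | rfl | rfl)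
    exacts [hH, hX, hY]
  refine eq_top_iff.2 fun b _ => ?_
  have hb : b ∈ T := hT ▸ Algebra.mem_top
  simpa using hb 1 h1

end Generators

section Lift

variable {a} {S : Type*} [Ring S] [Algebra k S] (H U V : S)

/-- The universal property of `k[h](σ_cl, a)`. -/
noncomputable def lift (h₁ : U * H = (H - 1) * U) (h₂ : V * H = (H + 1) * V)
    (h₃ : U * V = aeval (H - 1) a) (h₄ : V * U = aeval H a) : ClassicalGWA a →ₐ[k] S :=
  RingQuot.liftAlgHom k
    ⟨FreeAlgebra.lift k fun g => GWAGen.casesOn g H U V, by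
      intro b c hbc
      have hp (r : k[X]) : FreeAlgebra.lift k (fun g => GWAGen.casesOn g H U V)
          (GWAGen.poly r) = aeval H r := by
        rw [GWAGen.poly, ← aeval_algHom_apply, FreeAlgebra.lift_ι_apply]
      cases hbc with
      | x_h => rw [map_mul, map_mul, hp, sigmaCl_X]; simpa using h₁
      | y_h => rw [map_mul, map_mul, hp, sigmaCl_symm_X]; simpa using h₂
      | x_y => rw [map_mul, hp, sigmaCl_apply, aeval_comp]; simpa using h₃
      | y_x => rw [map_mul, hp]; simpa using h₄⟩

section

variable {H U V} (h₁ : U * H = (H - 1) * U) (h₂ : V * H = (H + 1) * V)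
  (h₃ : U * V = aeval (H - 1) a) (h₄ : V * U = aeval H a)

theorem lift_genH : lift H U V h₁ h₂ h₃ h₄ (genH a) = H := by
  rw [lift, genH, RingQuot.liftAlgHom_mkAlgHom_apply, FreeAlgebra.lift_ι_apply]

theorem lift_genX : lift H U V h₁ h₂ h₃ h₄ (genX a) = U := by
  rw [lift, genX, RingQuot.liftAlgHom_mkAlgHom_apply, FreeAlgebra.lift_ι_apply]

theorem lift_genY : lift H U V h₁ h₂ h₃ h₄ (genY a) = V := by
  rw [lift, genY, RingQuot.liftAlgHom_mkAlgHom_apply, FreeAlgebra.lift_ι_apply]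

end

/-- When `U` is right regular, the relations for `V * H` and `U * V` follow from the others. -/
theorem exists_algHom_of_isRightRegular {H U V : S} (hU : IsRightRegular U)
    (h₁ : U * H = (H - 1) * U) (h₄ : V * U = aeval H a) :
    ∃ F : ClassicalGWA a →ₐ[k] S, F (genH a) = H ∧ F (genX a) = U ∧ F (genY a) = V := by
  have h₂ : V * H = (H + 1) * V := hU <| by
    have hHU : H * U = U * (H + 1) := by rw [mul_add, h₁, sub_mul, mul_one, one_mul, sub_add_cancel]
    change V * H * U = (H + 1) * V * U
    rw [mul_assoc, hHU, ← mul_assoc, mul_assoc (H + 1), h₄]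
    have hH : (H + 1) * H = H * (H + 1) := by noncomm_ring
    exact (mul_aeval_of_mul_eq hH a).symm
  have h₃ : U * V = aeval (H - 1) a := hU <| by
    change U * V * U = _ * U
    rw [mul_assoc, h₄, mul_aeval_of_mul_eq h₁]
  exact ⟨lift H U V h₁ h₂ h₃ h₄, lift_genH .., lift_genX .., lift_genY ..⟩

end Lift

section NormalForm

/-- The generator of degree `l` over `k[h]`: a power of `x` or a power of `y`. -/
noncomputable def homGen (l : ℤ) : ClassicalGWA a := genX a ^ l.toNat * genY a ^ (-l).toNat

theorem homGen_natCast (m : ℕ) : homGen a m = genX a ^ m := by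
  simp [homGen]

theorem homGen_neg_natCast (m : ℕ) : homGen a (-m) = genY a ^ m := by
  simp [homGen]

/-- The element `∑ r_l(h) x ^ l` with coefficients `r_l`, where `x ^ (-m)` means `y ^ m`. -/
noncomputable def ofCoeffs : (ℤ →₀ k[X]) →ₗ[k] ClassicalGWA a :=
  Finsupp.lsum k fun l => LinearMap.mulRight k (homGen a l) ∘ₗ (aeval (genH a)).toLinearMap

theorem ofCoeffs_single (l : ℤ) (r : k[X]) :
    ofCoeffs a (Finsupp.single l r) = aeval (genH a) r * homGen a l := by
  simp [ofCoeffs]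

variable {a} in
theorem genX_mul_homGen_mem_range (l : ℤ) :
    ∃ (r : k[X]) (l' : ℤ), genX a * homGen a l = aeval (genH a) r * homGen a l' := by
  obtain ⟨m, rfl | rfl⟩ := l.eq_nat_or_neg
  · refine ⟨1, (m + 1 : ℕ), ?_⟩
    rw [homGen_natCast, homGen_natCast, map_one, one_mul, pow_succ']
  · rcases m with _ | m
    · exact ⟨1, (1 : ℕ), by rw [homGen_neg_natCast, homGen_natCast, map_one]; simp⟩
    · refine ⟨a.comp (X - 1), -m, ?_⟩
      rw [homGen_neg_natCast, homGen_neg_natCast, pow_succ', ← mul_assoc, genX_mul_genY, aeval_comp]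
      simp

variable {a} in
theorem genY_mul_homGen_mem_range (l : ℤ) :
    ∃ (r : k[X]) (l' : ℤ), genY a * homGen a l = aeval (genH a) r * homGen a l' := by
  obtain ⟨m, rfl | rfl⟩ := l.eq_nat_or_neg
  · rcases m with _ | m
    · exact ⟨1, -(1 : ℕ), by rw [homGen_neg_natCast, homGen_natCast, map_one]; simp⟩
    · refine ⟨a, m, ?_⟩
      rw [homGen_natCast, homGen_natCast, pow_succ', ← mul_assoc, genY_mul_genX]
  · refine ⟨1, -(m + 1 : ℕ), ?_⟩
    rw [homGen_neg_natCast, homGen_neg_natCast, map_one, one_mul, pow_succ']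

theorem ofCoeffs_surjective : Function.Surjective (ofCoeffs a) := by
  have hmem (r : k[X]) (l : ℤ) : aeval (genH a) r * homGen a l ∈ LinearMap.range (ofCoeffs a) :=
    ⟨_, ofCoeffs_single a l r⟩
  have hstable (c : ClassicalGWA a) (hc : ∀ (r : k[X]) (l : ℤ),
      c * (aeval (genH a) r * homGen a l) ∈ LinearMap.range (ofCoeffs a)) :
      ∀ b ∈ LinearMap.range (ofCoeffs a), c * b ∈ LinearMap.range (ofCoeffs a) := by
    rintro _ ⟨f, rfl⟩
    induction f using Finsupp.induction_linear with
    | zero => simp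
    | add f g hf hg => rw [map_add, mul_add]; exact add_mem hf hg
    | single l r => rw [ofCoeffs_single]; exact hc r l
  refine LinearMap.range_eq_top.1 (submodule_eq_top ?_ (hstable _ fun r l => ?_)
    (hstable _ fun r l => ?_) (hstable _ fun r l => ?_))
  · simpa [homGen] using hmem 1 0
  · have := hmem (X * r) l
    rwa [map_mul, aeval_X, mul_assoc] at this
  · obtain ⟨s, l', hs⟩ := genX_mul_homGen_mem_range (a := a) l
    have := hmem (r.comp (X - 1) * s) l'
    rw [map_mul, mul_assoc, ← hs, aeval_comp, map_sub, map_one, aeval_X] at this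
    rwa [← mul_assoc, mul_aeval_of_mul_eq (genX_mul_genH a), mul_assoc]
  · obtain ⟨s, l', hs⟩ := genY_mul_homGen_mem_range (a := a) l
    have := hmem (r.comp (X + 1) * s) l'
    rw [map_mul, mul_assoc, ← hs, aeval_comp, map_add, map_one, aeval_X] at this
    rwa [← mul_assoc, mul_aeval_of_mul_eq (genY_mul_genH a), mul_assoc]

end NormalForm

section Symbol

open SymbolRing

theorem starMul_comp_starMul (f g : SymbolRing k) :
    (starMul f * starMul g : Module.End k (SymbolRing k)) = starMul (starMul f g) :=
  LinearMap.ext fun e => (starMul_assoc f g e).symm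

theorem starMul_one_map : (starMul 1 : Module.End k (SymbolRing k)) = 1 :=
  LinearMap.ext one_starMul

theorem aeval_starMul_h (r : k[X]) :
    aeval (starMul (mon 1 0) : Module.End k (SymbolRing k)) r = starMul (aeval (mon 1 0) r) := by
  have hlmul (s : k[X]) : starMul (aeval (mon 1 0) s) =
      Algebra.lmul k (SymbolRing k) (aeval (mon 1 0) s) := LinearMap.ext (aeval_starMul s)
  have hX := hlmul X
  rw [aeval_X] at hX
  rw [hX, hlmul, aeval_algHom_apply]

theorem exists_algHom_starMul : ∃ F : ClassicalGWA a →ₐ[k] Module.End k (SymbolRing k),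
    F (genH a) = starMul (mon 1 0) ∧ F (genX a) = starMul (mon 0 1) ∧
      F (genY a) = starMul (aeval (mon 1 0) a * mon 0 (-1)) := by
  refine exists_algHom_of_isRightRegular
    (isRightRegular_of_mul_eq_one (b := starMul (mon 0 (-1))) ?_) ?_ ?_
  · rw [starMul_comp_starMul, starMul_mon_zero, ← mon_zero_add, ← starMul_one_map]
    rfl
  · rw [← starMul_one_map, ← map_sub, starMul_comp_starMul, starMul_comp_starMul, starMul_mon_zero,
      starMul_mon, Int.cast_one, shift_h, map_one, mul_comm]
  · rw [starMul_comp_starMul, starMul_mon_zero, mul_assoc, ← mon_zero_add, aeval_starMul_h]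
    simp [mon_zero_zero]

/-- The action on the symbol ring by left multiplication for `SymbolRing.starMul`. -/
noncomputable def rep : ClassicalGWA a →ₐ[k] Module.End k (SymbolRing k) :=
  (exists_algHom_starMul a).choose

theorem rep_genH : rep a (genH a) = starMul (mon 1 0) :=
  (exists_algHom_starMul a).choose_spec.1

theorem rep_genX : rep a (genX a) = starMul (mon 0 1) :=
  (exists_algHom_starMul a).choose_spec.2.1

theorem rep_genY : rep a (genY a) = starMul (aeval (mon 1 0) a * mon 0 (-1)) :=
  (exists_algHom_starMul a).choose_spec.2.2

/-- The symbol of an element, obtained by writing its normal form in the symbol ring with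
`y = a(h) * x⁻¹`. It turns the product into `SymbolRing.starMul`. -/
noncomputable def sym : ClassicalGWA a →ₗ[k] SymbolRing k :=
  LinearMap.applyₗ 1 ∘ₗ (rep a).toLinearMap

theorem sym_apply (b : ClassicalGWA a) : sym a b = rep a b 1 := rfl

theorem rep_eq_starMul_sym (b : ClassicalGWA a) : rep a b = starMul (sym a b) := by
  let T : Subalgebra k (Module.End k (SymbolRing k)) :=
    { carrier := Set.range starMul
      mul_mem' := by rintro _ _ ⟨f, rfl⟩ ⟨g, rfl⟩; exact ⟨_, (starMul_comp_starMul f g).symm⟩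
      add_mem' := by rintro _ _ ⟨f, rfl⟩ ⟨g, rfl⟩; exact ⟨f + g, map_add _ _ _⟩
      algebraMap_mem' := fun c => ⟨c • 1, by
        rw [map_smul, starMul_one_map, Algebra.algebraMap_eq_smul_one]⟩ }
  have hT : T.comap (rep a) = ⊤ := by
    rw [eq_top_iff, ← adjoin_generators, Algebra.adjoin_le_iff]
    rintro b (rfl | rfl | rfl)
    exacts [⟨_, (rep_genH a).symm⟩, ⟨_, (rep_genX a).symm⟩, ⟨_, (rep_genY a).symm⟩]
  obtain ⟨f, hf⟩ : rep a b ∈ T := Subalgebra.mem_comap _ _ _ |>.1 (hT ▸ Algebra.mem_top)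
  have hsym : sym a b = f := (LinearMap.congr_fun hf 1).symm.trans (starMul_one f)
  rw [hsym, hf]

variable {a} (b c : ClassicalGWA a)

theorem sym_mul : sym a (b * c) = starMul (sym a b) (sym a c) := by
  rw [sym_apply, map_mul, rep_eq_starMul_sym]
  rfl

theorem sym_one : sym a 1 = 1 := by
  rw [sym_apply, map_one (rep a), Module.End.one_apply]

theorem sym_genH : sym a (genH a) = mon 1 0 := by
  rw [sym_apply, rep_genH, starMul_one]

theorem sym_genX : sym a (genX a) = mon 0 1 := by
  rw [sym_apply, rep_genX, starMul_one]

theorem sym_genY : sym a (genY a) = aeval (mon 1 0) a * mon 0 (-1) := by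
  rw [sym_apply, rep_genY, starMul_one]

theorem sym_aeval_mul (r : k[X]) :
    sym a (aeval (genH a) r * b) = aeval (mon 1 0) r * sym a b := by
  rw [sym_mul, ← rep_eq_starMul_sym, ← aeval_algHom_apply, rep_genH, aeval_starMul_h, aeval_starMul]

theorem sym_mul_genX_pow (m : ℕ) : sym a (b * genX a ^ m) = sym a b * mon 0 m := by
  induction m with
  | zero => simp [mon_zero_zero]
  | succ m ih =>
    rw [pow_succ, ← mul_assoc, sym_mul, sym_genX, starMul_mon_zero, ih, mul_assoc, ← mon_zero_add,
      Nat.cast_succ]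

theorem sym_genX_pow (m : ℕ) : sym a (genX a ^ m) = mon 0 m := by
  rw [← one_mul (_ ^ _), sym_mul_genX_pow, sym_one, one_mul]

variable (a) in
/-- The symbol of `homGen a l` is `homGenCoeff a l * x ^ l`. -/
noncomputable def homGenCoeff (l : ℤ) : k[X] :=
  ∏ i ∈ Finset.range (-l).toNat, a.comp (X + C (i : k))

theorem sym_homGen (l : ℤ) :
    sym a (homGen a l) = aeval (mon 1 0) (homGenCoeff a l) * mon 0 l := by
  obtain ⟨m, rfl | rfl⟩ := l.eq_nat_or_neg
  · rw [homGen_natCast, sym_genX_pow]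
    simp [homGenCoeff]
  rw [homGen_neg_natCast, homGenCoeff, neg_neg, Int.toNat_natCast]
  induction m with
  | zero => simp [sym_one, mon_zero_zero]
  | succ m ih =>
    rw [pow_succ, sym_mul, ih, sym_genY, starMul_aeval_mul, starMul_mon, map_mul, shift_aeval,
      shift_mon_zero, Finset.prod_range_succ, map_mul, Nat.cast_succ, neg_add, mon_zero_add]
    simp only [Int.cast_neg, Int.cast_natCast, map_neg, sub_neg_eq_add]
    ring

theorem slice_sym_ofCoeffs (f : ℤ →₀ k[X]) (l : ℤ) :
    slice l (sym a (ofCoeffs a f)) = f l * homGenCoeff a l := by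
  classical
  induction f using Finsupp.induction_linear with
  | zero => simp
  | add f g hf hg => rw [map_add, map_add, map_add, hf, hg, Finsupp.add_apply, add_mul]
  | single l' r =>
    rw [ofCoeffs_single, sym_aeval_mul, sym_homGen, ← mul_assoc, ← map_mul, slice_aeval_mul_mon,
      Finsupp.single_apply]
    split_ifs with h
    · rw [h]
    · rw [zero_mul]

theorem homGenCoeff_dvd_slice_sym (l : ℤ) : homGenCoeff a l ∣ slice l (sym a b) := by
  obtain ⟨f, rfl⟩ := ofCoeffs_surjective a b
  rw [slice_sym_ofCoeffs]
  exact dvd_mul_left _ _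

theorem homGenCoeff_ne_zero (ha : a ≠ 0) (l : ℤ) : homGenCoeff a l ≠ 0 :=
  Finset.prod_ne_zero_iff.2 fun _ _ => by rwa [Ne, comp_X_add_C_eq_zero_iff]

theorem natDegree_homGenCoeff (ha : a ≠ 0) (l : ℤ) :
    (homGenCoeff a l).natDegree = a.natDegree * (-l).toNat := by
  rw [homGenCoeff, natDegree_prod _ _ fun _ _ => by rwa [Ne, comp_X_add_C_eq_zero_iff]]
  simp_rw [natDegree_comp, natDegree_X_add_C]
  simp [mul_comm]

theorem sym_injective (ha : a ≠ 0) : Function.Injective (sym a) := by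
  rw [injective_iff_map_eq_zero]
  intro b hb
  obtain ⟨f, rfl⟩ := ofCoeffs_surjective a b
  suffices f = 0 by rw [this, map_zero]
  ext1 l
  have hl := slice_sym_ofCoeffs (a := a) f l
  rw [hb, map_zero, eq_comm, mul_eq_zero] at hl
  exact hl.resolve_right (homGenCoeff_ne_zero ha l)

theorem isRightRegular_genX (ha : a ≠ 0) : IsRightRegular (genX a) := by
  intro b c h
  refine sym_injective ha (mul_right_cancel₀ (mon_ne_zero 0 1) ?_)
  rw [← starMul_mon_zero, ← starMul_mon_zero, ← sym_genX, ← sym_mul, ← sym_mul]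
  exact congrArg _ h

end Symbol

end ClassicalGWA

section AdNilpotent

/-- An element `z` of a ring is ad-nilpotent if `[z, ·]` is nilpotent at every element. -/
def IsAdNilpotent {A : Type*} [Ring A] (z : A) : Prop := ∀ b : A, IsNilAt (⁅z, ·⁆) b

theorem IsAdNilpotent.map {A B F : Type*} [Ring A] [Ring B] [FunLike F A B] [RingHomClass F A B]
    {z : A} (hz : IsAdNilpotent z) (φ : F) (hφ : Function.Surjective φ) :
    IsAdNilpotent (φ z) := by
  intro b
  obtain ⟨b, rfl⟩ := hφ b
  obtain ⟨m, hm⟩ := hz b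
  have hcomm : Function.Semiconj φ (⁅z, ·⁆) (⁅φ z, ·⁆) := fun c => by
    simp only [Ring.lie_def, map_sub, map_mul]
  exact ⟨m, by rw [← hcomm.iterate_right m b, hm, map_zero]⟩

end AdNilpotent

namespace SymbolRing

variable {k : Type*} [Field k]

instance [CharZero k] : CharZero (SymbolRing k) :=
  charZero_of_injective_algebraMap (algebraMap k _).injective

theorem isNilAt_bracket_of_hasLeadingForm {q p W V : ℤ} {f f₀ g g₀ : SymbolRing k}
    (hf : HasLeadingForm q p W f f₀) (hg : HasLeadingForm q p V g g₀) (hq : 0 < q)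
    (h : IsNilAt (fun e => starMul f e - starMul e f) g) : IsNilAt (bracket f₀) g₀ := by
  obtain ⟨m, hm⟩ := h
  have hlead : HasLeadingForm q p (V + m * (W - q))
      ((fun e => starMul f e - starMul e f)^[m] g) ((bracket f₀)^[m] g₀) := by
    clear hm
    induction m with
    | zero => simpa using hg
    | succ m ih =>
      rw [Function.iterate_succ_apply', Function.iterate_succ_apply']
      convert hasLeadingForm_starMul_sub_starMul hf ih hq using 1
      push_cast
      ring
  rw [hm] at hlead
  exact ⟨m, hlead.eq_zero⟩

theorem mem_nilSubalgebra_mon_of_cone {D : Derivation k (SymbolRing k) (SymbolRing k)} {n : ℕ}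
    (hh : IsNilAt D (mon 1 0)) (hx : IsNilAt D (mon 0 1)) (hy : IsNilAt D (mon n (-1)))
    {i : ℕ} {l : ℤ} (hil : 0 ≤ i + n * l) : mon i l ∈ nilSubalgebra D := by
  obtain ⟨m, rfl | rfl⟩ := l.eq_nat_or_neg
  · have : (mon i m : SymbolRing k) = mon 1 0 ^ i * mon 0 1 ^ m := by simp [mon_pow, mon_mul_mon]
    rw [this]
    exact mul_mem (pow_mem hh _) (pow_mem hx _)
  · obtain ⟨j, rfl⟩ : ∃ j, i = j + m * n := Nat.exists_eq_add_of_le' (by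
      zify; linarith)
    have : (mon (j + m * n) (-m) : SymbolRing k) = mon 1 0 ^ j * mon n (-1) ^ m := by
      simp [mon_pow, mon_mul_mon]
    rw [this]
    exact mul_mem (pow_mem hh _) (pow_mem hy _)

/-- Since `h` divides `h ^ i * x ^ l` in the cone, it lies in the factorially closed kernel of the
bracket, which forces `l = 0`; then `{f, x} = c * i * h ^ (i - 1) * x` is not of lower degree
than `x`. -/
theorem not_forall_isNilAt_bracket_smul_mon [CharZero k] {c : k} (hc : c ≠ 0) {n i : ℕ} {l : ℤ}
    (hi : 0 < i) (hil : 0 < i + n * l)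
    (h : ∀ (i' : ℕ) (l' : ℤ), 0 ≤ i' + n * l' →
      IsNilAt (bracket (c • mon i l : SymbolRing k)) (mon i' l')) : False := by
  set f : SymbolRing k := c • mon i l with hf
  obtain ⟨i, rfl⟩ : ∃ j, i = j + 1 := Nat.exists_eq_add_of_le' hi
  have hf0 : f ≠ 0 := smul_ne_zero hc (mon_ne_zero _ _)
  have hfactor : mon 1 0 * (c • mon i l) = f := by
    rw [mul_smul_comm, mon_mul_mon, hf, add_comm 1 i, zero_add]
  have hh : bracket f (mon 1 0) = 0 := by
    refine (apply_eq_zero_of_apply_mul_eq_zero (h 1 0 (by simp)) (b := c • mon i l) ?_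
      (by rwa [hfactor]) (by rw [hfactor, bracket_self])).1
    exact (nilSubalgebra (bracket f)).smul_mem (h i l (by push_cast at hil; linarith)) c
  obtain rfl : l = 0 := by
    rw [bracket_h, hf, Derivation.map_smul, xdx_mon, neg_eq_zero, smul_comm, ← hf,
      smul_eq_zero, or_iff_left hf0] at hh
    exact_mod_cast hh
  have hdf : dh f = (c * (i + 1 : ℕ)) • mon 1 0 ^ i := by
    rw [hf, Derivation.map_smul, dh_mon, smul_smul, mon_pow]
    simp
  have hdf0 : dh f ≠ 0 := by
    rw [hdf]
    exact smul_ne_zero (mul_ne_zero hc (Nat.cast_ne_zero.2 i.succ_ne_zero))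
      (pow_ne_zero _ (mon_ne_zero _ _))
  have hdf_deg : HasNilDegree (bracket f) (dh f) 0 := hasNilDegree_zero_iff.2 ⟨hdf0, by
    rw [hdf, Derivation.map_smul, Derivation.leibniz_pow, hh]
    simp⟩
  obtain ⟨d, hd⟩ := (h 0 1 (by simp)).exists_hasNilDegree (mon_ne_zero _ _)
  have hx := hdf_deg.mul hd
  rw [← bracket_x] at hx
  rcases d with _ | d
  · exact hx.1 hd.2
  · have := hx.unique hd.apply
    omega

theorem hasLeadingForm_aeval_mul_mon {q p : ℤ} (hq : 0 < q) (r : k[X]) (l : ℤ) :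
    HasLeadingForm q p (q * r.natDegree + p * l) (aeval (mon 1 0 : SymbolRing k) r * mon 0 l)
      (r.leadingCoeff • mon r.natDegree l) := by
  refine ⟨Submodule.smul_mem _ _ (mon_mem_supp rfl), ?_⟩
  rw [aeval_eq_sum_range, Finset.sum_range_succ, add_mul, leadingCoeff, smul_mul_assoc,
    ← mon_eq_pow_mul, add_sub_cancel_right, Finset.sum_mul]
  refine sum_mem fun i hi => ?_
  rw [smul_mul_assoc, ← mon_eq_pow_mul]
  refine Submodule.smul_mem _ _ (mon_mem_supp ?_)
  have : (i : ℤ) + 1 ≤ r.natDegree := by exact_mod_cast Finset.mem_range.1 hi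
  nlinarith

theorem eq_and_eq_of_perturbed_weight_eq {K q p l l' : ℤ} {i i' : ℕ} (hq : 0 < q)
    (hl : |l' - l| < K) (hW : K * q * i' + (K * p + 1) * l' = K * q * i + (K * p + 1) * l) :
    i = i' ∧ l = l' := by
  have hK : K ≠ 0 := ((abs_nonneg _).trans_lt hl).ne'
  have hdvd : l' - l = K * (q * (i - i') + p * (l - l')) := by linarith
  obtain rfl : l' = l := sub_eq_zero.1 (Int.eq_zero_of_abs_lt_dvd ⟨_, hdvd⟩ hl)
  rw [sub_self, mul_zero, add_zero, zero_eq_mul, or_iff_right hK, mul_eq_zero,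
    or_iff_right hq.ne'] at hdvd
  exact ⟨by omega, rfl⟩

/-- Perturbing the weights slightly makes the leading form a monomial. -/
theorem exists_hasLeadingForm_smul_mon {q p : ℤ} (hq : 0 < q) {u v : ℕ} {f : SymbolRing k}
    (hf : f ≠ 0) (hsupp : f ∈ supp fun _ l => -v ≤ l ∧ l ≤ u) :
    ∃ (K : ℤ) (i : ℕ) (l : ℤ), 0 < K ∧ f.coeff (i, l) ≠ 0 ∧ f ∈ weightLE k q p (q * i + p * l) ∧
      HasLeadingForm (K * q) (K * p + 1) (K * q * i + (K * p + 1) * l) f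
        (f.coeff (i, l) • mon i l) := by
  set K : ℤ := u + v + 1
  have hKpos : 0 < K := by positivity
  have hne : f.coeff.support.Nonempty := by
    rw [Finsupp.support_nonempty_iff]
    contrapose! hf
    ext t
    rw [hf, AddMonoidAlgebra.coeff_zero]
  obtain ⟨⟨i, l⟩, hil, hmax⟩ := Finset.exists_max_image f.coeff.support
    (fun t : ℕ × ℤ => K * q * t.1 + (K * p + 1) * t.2) hne
  rw [Finsupp.mem_support_iff] at hil
  have hmax' {i' : ℕ} {l' : ℤ} (h : f.coeff (i', l') ≠ 0) :
      K * q * i' + (K * p + 1) * l' ≤ K * q * i + (K * p + 1) * l :=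
    hmax (i', l') (Finsupp.mem_support_iff.2 h)
  have hwidth := mem_supp.1 hsupp
  have hunique {i' : ℕ} {l' : ℤ} (h : f.coeff (i', l') ≠ 0)
      (hW : K * q * i' + (K * p + 1) * l' = K * q * i + (K * p + 1) * l) : i = i' ∧ l = l' := by
    obtain ⟨hl, hu⟩ := hwidth i l hil
    obtain ⟨hl', hu'⟩ := hwidth i' l' h
    exact eq_and_eq_of_perturbed_weight_eq hq (abs_lt.2 ⟨by omega, by omega⟩) hW
  have hle : f ∈ weightLE k (K * q) (K * p + 1) (K * q * i + (K * p + 1) * l) :=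
    mem_supp.2 fun i' l' h => hmax' h
  have htop : topPart (K * q) (K * p + 1) (K * q * i + (K * p + 1) * l) f =
      f.coeff (i, l) • mon i l := by
    ext ⟨i', l'⟩
    rw [coeff_topPart, AddMonoidAlgebra.coeff_smul, Finsupp.smul_apply, coeff_mon]
    by_cases heq : i = i' ∧ l = l'
    · obtain ⟨rfl, rfl⟩ := heq
      simp
    · rw [if_neg heq, smul_zero, ite_eq_right_iff]
      exact fun hW => by_contra fun h => heq (hunique h hW)
  refine ⟨K, i, l, hKpos, hil, mem_supp.2 fun i' l' h => ?_, htop ▸ hasLeadingForm_topPart hle⟩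
  have := hmax' h
  have := hwidth i l hil
  have := hwidth i' l' h
  by_contra! hlt
  nlinarith

end SymbolRing

namespace ClassicalGWA

open SymbolRing

variable {k : Type*} [Field k] {a : k[X]} {z : ClassicalGWA a} {q p W : ℤ}

theorem isNilAt_starMul_sub_starMul_sym (hz : IsAdNilpotent z) (b : ClassicalGWA a) :
    IsNilAt (fun e => starMul (sym a z) e - starMul e (sym a z)) (sym a b) := by
  obtain ⟨m, hm⟩ := hz b
  have hcomm : Function.Semiconj (sym a) (⁅z, ·⁆)
      (fun e => starMul (sym a z) e - starMul e (sym a z)) := fun c => by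
    simp only [Ring.lie_def, map_sub, sym_mul]
  exact ⟨m, by rw [← hcomm.iterate_right m b, hm, map_zero]⟩

theorem isNilAt_bracket_mon_of_isAdNilpotent (ha : a ≠ 0) (hz : IsAdNilpotent z) (hq : 0 < q)
    {f₀ : SymbolRing k} (hf₀ : HasLeadingForm q p W (sym a z) f₀) {i : ℕ} {l : ℤ}
    (hil : 0 ≤ i + a.natDegree * l) : IsNilAt (bracket f₀) (mon i l) := by
  have hnil {V : ℤ} {b : ClassicalGWA a} {g₀ : SymbolRing k}
      (hg₀ : HasLeadingForm q p V (sym a b) g₀) : IsNilAt (bracket f₀) g₀ :=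
    isNilAt_bracket_of_hasLeadingForm hf₀ hg₀ hq (isNilAt_starMul_sub_starMul_sym hz b)
  refine mem_nilSubalgebra_mon_of_cone (hnil (V := q) (b := genH a) ?_)
    (hnil (V := p) (b := genX a) ?_) ?_ hil
  · rw [sym_genH]
    exact hasLeadingForm_self (mon_mem_supp (by simp))
  · rw [sym_genX]
    exact hasLeadingForm_self (mon_mem_supp (by simp))
  · have hy := hasLeadingForm_aeval_mul_mon hq (p := p) a (-1)
    rw [← sym_genY] at hy
    have := (nilSubalgebra (bracket f₀)).smul_mem (hnil hy) a.leadingCoeff⁻¹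
    rwa [inv_smul_smul₀ (leadingCoeff_ne_zero.2 ha)] at this

theorem natDegree_mul_neg_le_natDegree_slice (ha : a ≠ 0) {l : ℤ} (hl : slice l (sym a z) ≠ 0) :
    (a.natDegree : ℤ) * -l ≤ (slice l (sym a z)).natDegree := by
  have hdeg := natDegree_le_of_dvd (homGenCoeff_dvd_slice_sym z l) hl
  rw [natDegree_homGenCoeff ha] at hdeg
  exact (mul_le_mul_of_nonneg_left (Int.self_le_toNat (-l)) (Nat.cast_nonneg _)).trans
    (by exact_mod_cast hdeg)

theorem weight_le_of_coeff_sym_ne_zero (ha : a ≠ 0) (hq : 0 ≤ q) (hz : sym a z ∈ weightLE k q p W)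
    {i : ℕ} {l : ℤ} (hil : (sym a z).coeff (i, l) ≠ 0) : q * (a.natDegree * -l) + p * l ≤ W := by
  have hslice : slice l (sym a z) ≠ 0 := fun h0 => hil (by rw [← coeff_slice, h0, coeff_zero])
  have hlead : (sym a z).coeff ((slice l (sym a z)).natDegree, l) ≠ 0 := by
    rwa [← coeff_slice, coeff_natDegree, leadingCoeff_ne_zero]
  have := mem_supp.1 hz _ _ hlead
  have := mul_le_mul_of_nonneg_left (natDegree_mul_neg_le_natDegree_slice ha hslice) hq
  linarith

theorem nonneg_of_coeff_sym_ne_zero (ha : a ≠ 0) (hq : 0 < q) (hz : sym a z ∈ weightLE k q p W)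
    {i : ℕ} {l : ℤ} (hil : (sym a z).coeff (i, l) ≠ 0) (hW : q * i + p * l = W) :
    0 ≤ i + a.natDegree * l := by
  have := weight_le_of_coeff_sym_ne_zero ha hq.le hz hil
  exact nonneg_of_mul_nonneg_right (by linarith : 0 ≤ q * (i + a.natDegree * l)) hq

/-- The Newton polygon of an ad-nilpotent element lies in the triangle spanned by the vertices
`1`, `x ^ u` and `h ^ (n * v) * x ^ (-v)`. -/
theorem weight_le_of_isAdNilpotent [CharZero k] (ha : a ≠ 0) (hz : IsAdNilpotent z) {u v : ℕ}
    (huv : 0 < u + v) (hsupp : sym a z ∈ supp fun _ l => -v ≤ l ∧ l ≤ u) :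
    sym a z ∈ weightLE k (u + v) (a.natDegree * v) (a.natDegree * u * v) := by
  rcases eq_or_ne (sym a z) 0 with h0 | h0
  · rw [h0]
    exact zero_mem _
  have hq : (0 : ℤ) < u + v := by exact_mod_cast huv
  obtain ⟨K, i, l, hK, hcoeff, hle, hlead⟩ :=
    exists_hasLeadingForm_smul_mon (p := a.natDegree * v) hq h0 hsupp
  have hKq := mul_pos hK hq
  have hcone : 0 ≤ i + a.natDegree * l :=
    nonneg_of_coeff_sym_ne_zero ha hKq hlead.mem_weightLE hcoeff rfl
  have hedge : i = 0 ∨ i + a.natDegree * l = 0 := by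
    by_contra! hne
    exact not_forall_isNilAt_bracket_smul_mon hcoeff (Nat.pos_of_ne_zero hne.1)
      (lt_of_le_of_ne hcone hne.2.symm)
      fun _ _ => isNilAt_bracket_mon_of_isAdNilpotent ha hz hKq hlead
  refine weightLE_mono ?_ hle
  obtain ⟨hl, hu⟩ := mem_supp.1 hsupp i l hcoeff
  rcases hedge with rfl | hi
  · have := mul_le_mul_of_nonneg_left hu (by positivity : (0 : ℤ) ≤ a.natDegree * v)
    push_cast
    linarith
  · have := mul_le_mul_of_nonneg_left hl (by positivity : (0 : ℤ) ≤ a.natDegree * u)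
    rw [eq_neg_of_add_eq_zero_left hi]
    linarith

end ClassicalGWA

section HomogenizedNilDegree

variable {k A : Type*} [Field k] [CommRing A] [Algebra k A] {a b : A} {r : k} {P : k[X]}
  {L E e : ℕ}

theorem aeval_homogenize_eq_sum (a b : A) (P : k[X]) (L : ℕ) :
    MvPolynomial.aeval ![a, b] (P.homogenize L) =
      ∑ s ∈ Finset.HasAntidiagonal.antidiagonal L, P.coeff s.1 • (a ^ s.1 * b ^ s.2) := by
  simp [homogenize, MvPolynomial.aeval_monomial, Algebra.smul_def, Finsupp.update_eq_add_single,
    Finsupp.prod_add_index', pow_add]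

theorem aeval_homogenize_X_sub_C (a b : A) (r : k) :
    MvPolynomial.aeval ![a, b] ((X - C r).homogenize 1) = a - r • b := by
  have hsub := map_sub (homogenizeLM (R := k) 1) X (C r)
  rw [homogenizeLM_apply] at hsub
  simp [hsub, Algebra.smul_def]

theorem aeval_homogenize_mul (a b : A) {Q : k[X]} {L' : ℕ} (hP : P.natDegree ≤ L)
    (hQ : Q.natDegree ≤ L') :
    MvPolynomial.aeval ![a, b] ((P * Q).homogenize (L + L')) =
      MvPolynomial.aeval ![a, b] (P.homogenize L) *
        MvPolynomial.aeval ![a, b] (Q.homogenize L') := by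
  rw [homogenize_mul _ _ hP hQ, map_mul]

theorem natDegree_X_sub_C_pow_le (r : k) (L : ℕ) : ((X - C r) ^ L).natDegree ≤ L := by
  simp

theorem aeval_homogenize_X_sub_C_pow (a b : A) (r : k) (L : ℕ) :
    MvPolynomial.aeval ![a, b] (((X - C r) ^ L).homogenize L) = (a - r • b) ^ L := by
  induction L with
  | zero => simp
  | succ L ih =>
    rw [pow_succ, aeval_homogenize_mul a b (natDegree_X_sub_C_pow_le r L)
      (natDegree_X_sub_C_le r), ih, aeval_homogenize_X_sub_C, pow_succ]

theorem derivation_aeval_homogenize (d : Derivation k A A) (hb : d b = 0)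
    (hP : P.natDegree ≤ L + 1) :
    d (MvPolynomial.aeval ![a, b] (P.homogenize (L + 1))) =
      MvPolynomial.aeval ![a, b] (P.derivative.homogenize L) * d a := by
  refine induction_with_natDegree_le (fun P => d (MvPolynomial.aeval ![a, b]
    (P.homogenize (L + 1))) = MvPolynomial.aeval ![a, b] (P.derivative.homogenize L) * d a)
    (L + 1) (by simp) (fun m c _ hm => ?_) (fun P Q _ _ hP hQ => ?_) P hP
  · rcases m with _ | m
    · simp [Derivation.leibniz_pow, hb]
    · have hder : derivative (C c * X ^ (m + 1) : k[X]) = C (c * (m + 1 : ℕ)) * X ^ m := by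
        simp [mul_assoc]
      rw [hder, homogenize_C_mul, homogenize_C_mul, homogenize_X_pow hm, homogenize_X_pow
        (Nat.le_of_succ_le_succ hm)]
      simp only [Nat.succ_eq_add_one, Nat.reduceAdd, Fin.isValue, Nat.reduceSubDiff, map_mul,
        MvPolynomial.algHom_C, map_pow, MvPolynomial.aeval_X, Matrix.cons_val_zero,
        Matrix.cons_val_one, Matrix.cons_val_fin_one, Derivation.leibniz, Derivation.leibniz_pow,
        hb, smul_eq_mul, mul_zero, add_tsub_cancel_right, nsmul_eq_mul, Nat.cast_add,
        Nat.cast_one, zero_add, Derivation.map_algebraMap, add_zero, map_natCast, map_add,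
        map_one]
      ring
  · simp only [homogenize_add, map_add, hP, hQ, add_mul]

variable {D : Derivation k A A}

theorem hasNilDegree_algebraMap [Nontrivial A] {c : k} (hc : c ≠ 0) :
    HasNilDegree D (algebraMap k A c) 0 :=
  hasNilDegree_zero_iff.2 ⟨(_root_.map_ne_zero _).2 hc, D.map_algebraMap c⟩

variable [IsDomain A] [CharZero A]

theorem iterate_aeval_homogenize_eq_zero (ha : HasNilDegree D a E) (hb : HasNilDegree D b E)
    (P : k[X]) (L : ℕ) : D^[L * E + 1] (MvPolynomial.aeval ![a, b] (P.homogenize L)) = 0 := by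
  rw [aeval_homogenize_eq_sum, ← Derivation.coeFn_coe, ← Module.End.pow_apply, map_sum]
  refine Finset.sum_eq_zero fun s hs => ?_
  have hdeg := (ha.pow s.1).mul (hb.pow s.2)
  rw [← add_mul, Finset.HasAntidiagonal.mem_antidiagonal.1 hs] at hdeg
  rw [map_smul, Module.End.pow_apply, Derivation.coeFn_coe, hdeg.2, smul_zero]

theorem hasNilDegree_aeval_homogenize_of_eval_ne_zero (ha : HasNilDegree D a E)
    (hb : HasNilDegree D b E) (hu : D^[E] (a - r • b) = 0) (hP : P.natDegree ≤ L)
    (hr : P.eval r ≠ 0) :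
    HasNilDegree D (MvPolynomial.aeval ![a, b] (P.homogenize L)) (L * E) := by
  rcases L with _ | L
  · rw [eq_C_of_natDegree_le_zero hP, eval_C] at hr
    rw [eq_C_of_natDegree_le_zero hP]
    simpa using hasNilDegree_algebraMap hr
  have hdecomp : P = C (P.eval r) + (X - C r) * (P /ₘ (X - C r)) := by
    rw [← modByMonic_X_sub_C_eq_C_eval, modByMonic_add_div]
  set Q := P /ₘ (X - C r) with hQ_def
  have hQ : Q.natDegree ≤ L := by
    rw [hQ_def, natDegree_divByMonic _ (monic_X_sub_C r), natDegree_X_sub_C]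
    omega
  have hF : MvPolynomial.aeval ![a, b] (P.homogenize (L + 1)) =
      algebraMap k A (P.eval r) * b ^ (L + 1) +
        (a - r • b) * MvPolynomial.aeval ![a, b] (Q.homogenize L) := by
    conv_lhs => rw [hdecomp]
    rw [homogenize_add, map_add, add_comm L 1, aeval_homogenize_mul a b (natDegree_X_sub_C_le r) hQ,
      aeval_homogenize_X_sub_C]
    simp
  have hrem : D^[(L + 1) * E] ((a - r • b) * MvPolynomial.aeval ![a, b] (Q.homogenize L)) = 0 := by
    rw [Nat.succ_mul, add_comm, iterate_add_mul_of_iterate_succ_eq_zero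
      (iterate_eq_zero_of_le D E.le_succ hu) (iterate_aeval_homogenize_eq_zero ha hb Q L), hu]
    simp
  rw [hF]
  have hlead := (hasNilDegree_algebraMap (D := D) hr).mul (hb.pow (L + 1))
  rw [zero_add] at hlead
  exact hlead.add_of_iterate_eq_zero hrem

theorem hasNilDegree_aeval_homogenize (ha : HasNilDegree D a E) (hb : HasNilDegree D b E)
    (hu : HasNilDegree D (a - r • b) e) (he : e < E) (hP : P.natDegree ≤ L) (hP0 : P ≠ 0) :
    HasNilDegree D (MvPolynomial.aeval ![a, b] (P.homogenize L))
      (P.rootMultiplicity r * e + (L - P.rootMultiplicity r) * E) := by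
  obtain ⟨Q, hQ, hr⟩ := exists_eq_pow_rootMultiplicity_mul_and_not_dvd P hP0 r
  rw [dvd_iff_isRoot] at hr
  set M := P.rootMultiplicity r
  have hdeg : P.natDegree = M + Q.natDegree := by
    rw [hQ, natDegree_mul (pow_ne_zero _ (X_sub_C_ne_zero r)) (by rintro rfl; simp at hr)]
    simp
  obtain ⟨L, rfl⟩ : ∃ L', L = M + L' := Nat.exists_eq_add_of_le (by omega)
  rw [hQ, aeval_homogenize_mul a b (natDegree_X_sub_C_pow_le r M) (by omega),
    aeval_homogenize_X_sub_C_pow, Nat.add_sub_cancel_left]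
  exact (hu.pow M).mul (hasNilDegree_aeval_homogenize_of_eval_ne_zero ha hb
    (iterate_eq_zero_of_le D he hu.2) (by omega) hr)

theorem HasNilDegree.of_sub_smul (hu : HasNilDegree D (a - r • b) e) (hb : HasNilDegree D b E)
    (he : e < E) (hr : r ≠ 0) : HasNilDegree D a E := by
  have hrb := (hasNilDegree_algebraMap (D := D) hr).mul hb
  rw [zero_add, ← Algebra.smul_def] at hrb
  simpa using hrb.add_of_iterate_eq_zero (iterate_eq_zero_of_le D he hu.2)

theorem exists_hasNilDegree_aeval_homogenize_of_forall_root [IsAlgClosed k] (hP0 : P ≠ 0)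
    (h : ∀ r, P.IsRoot r → ∃ m, E ≤ m ∧ HasNilDegree D (a - r • b) m) :
    ∃ m, P.natDegree * E ≤ m ∧
      HasNilDegree D (MvPolynomial.aeval ![a, b] (P.homogenize P.natDegree)) m := by
  induction hN : P.natDegree generalizing P with
  | zero =>
    rw [eq_C_of_natDegree_eq_zero hN, Ne, C_eq_zero] at hP0
    rw [eq_C_of_natDegree_eq_zero hN]
    exact ⟨0, by simp, by simpa using hasNilDegree_algebraMap hP0⟩
  | succ N ih =>
    obtain ⟨r, hr⟩ := IsAlgClosed.exists_root P
      (degree_ne_of_natDegree_ne (by rw [hN]; exact N.succ_ne_zero))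
    obtain ⟨Q, rfl⟩ := dvd_iff_isRoot.2 hr
    have hQ0 := right_ne_zero_of_mul hP0
    have hQ : Q.natDegree = N := by
      rw [natDegree_mul (X_sub_C_ne_zero r) hQ0, natDegree_X_sub_C] at hN
      omega
    obtain ⟨m, hm, hm'⟩ := ih hQ0 (fun s hs => h s (hs.dvd (dvd_mul_left _ _))) hQ
    obtain ⟨l, hl, hl'⟩ := h r hr
    rw [add_comm N 1, aeval_homogenize_mul a b (natDegree_X_sub_C_le r) hQ.le,
      aeval_homogenize_X_sub_C]
    exact ⟨l + m, by rw [add_mul]; omega, hl'.mul hm'⟩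

end HomogenizedNilDegree

namespace SymbolRing

section Edge

variable {k : Type*} [Field k] {D : Derivation k (SymbolRing k) (SymbolRing k)}
  {f : SymbolRing k} {P : k[X]} {r : k} {i j p q N m w E e : ℕ}

theorem aeval_homogenize_mon (p q N : ℕ) (P : k[X]) :
    MvPolynomial.aeval ![mon p 0, mon 0 q] (P.homogenize N) =
      ∑ s ∈ Finset.HasAntidiagonal.antidiagonal N,
        P.coeff s.1 • (mon (s.1 * p) (s.2 * q) : SymbolRing k) := by
  simp only [aeval_homogenize_eq_sum, mon_pow, mon_mul_mon, mul_zero, zero_add, add_zero]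

theorem hasNilDegree_mon_left [CharZero k] (hh : HasNilDegree D (mon 1 0) m) (s : ℕ) :
    HasNilDegree D (mon s 0) (s * m) := by
  simpa [mon_pow] using hh.pow s

theorem hasNilDegree_mon_right [CharZero k] (hx : HasNilDegree D (mon 0 1) w) (s : ℕ) :
    HasNilDegree D (mon 0 s) (s * w) := by
  simpa [mon_pow] using hx.pow s

theorem coeff_aeval_homogenize_mon (hq : 0 < q) (hs : i + j = N) :
    (MvPolynomial.aeval ![mon p 0, mon 0 q] (P.homogenize N)).coeff (i * p, ((j * q : ℕ) : ℤ)) =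
      P.coeff i := by
  rw [aeval_homogenize_mon, AddMonoidAlgebra.coeff_sum, Finsupp.finsetSum_apply,
    Finset.sum_eq_single (i, j)]
  · simp [coeff_mon]
  · intro s hs hne
    have hs2 : s.2 ≠ j := fun h2 => hne <| Prod.ext
      (by rw [Finset.HasAntidiagonal.mem_antidiagonal] at hs; omega) h2
    rw [AddMonoidAlgebra.coeff_smul, Finsupp.smul_apply, coeff_mon, if_neg, smul_zero]
    exact fun h => hs2 (Nat.eq_of_mul_eq_mul_right hq (by exact_mod_cast h.2))
  · exact fun h => absurd (Finset.HasAntidiagonal.mem_antidiagonal.2 hs) h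

theorem exists_mul_mon_eq_aeval_homogenize (hp : 0 < p) (hq : 0 < q) (hpq : p.Coprime q)
    (hN : q * N = i + j)
    (hf : f ∈ supp fun s l => q * s + p * l = p * j ∧ -i ≤ l) :
    ∃ P : k[X], P.natDegree ≤ N ∧
      f * mon 0 i = MvPolynomial.aeval ![mon p 0, mon 0 q] (P.homogenize N) := by
  let T : k[X] →ₗ[k] SymbolRing k :=
    (MvPolynomial.aeval ![mon p 0, mon 0 q]).toLinearMap ∘ₗ homogenizeLM N
  suffices LinearMap.mulRight k (mon 0 i) f ∈ (degreeLE k N).map T by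
    obtain ⟨P, hP, hPf⟩ := this
    exact ⟨P, natDegree_le_of_degree_le (mem_degreeLE.1 hP), hPf.symm⟩
  refine map_mem_of_mem_supp _ (fun s l hsl => ?_) hf
  obtain ⟨t, rfl⟩ : p ∣ s := by
    refine hpq.dvd_of_dvd_mul_left (Int.natCast_dvd_natCast.1 ⟨j - l, ?_⟩)
    push_cast
    linarith [hsl.1]
  have hl : q * t + l = j := by
    have := hsl.1
    push_cast at this
    exact mul_left_cancel₀ (Nat.cast_ne_zero.2 hp.ne' : (p : ℤ) ≠ 0) (by linarith)
  have hN' : (q : ℤ) * N = i + j := by exact_mod_cast hN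
  have htN : t ≤ N := by
    refine Nat.le_of_mul_le_mul_left ?_ hq
    zify
    linarith [hsl.2, hN']
  refine ⟨X ^ t, mem_degreeLE.2 (degree_X_pow_le t |>.trans (by exact_mod_cast htN)), ?_⟩
  have hlt : l + i = q * (N - t : ℕ) := by
    push_cast [htN]
    linarith
  simp [T, homogenize_X_pow htN, mon_pow, mon_mul_mon, hlt, mul_comm]

/-- If no factor `h ^ p - r * x ^ q` of `f * x ^ i` had small degree, then `x ^ i` would have the
degree of `x ^ (i + j)`. -/
theorem exists_hasNilDegree_sub_smul_lt [IsAlgClosed k] [CharZero k] (hh : IsNilAt D (mon 1 0))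
    (hx : HasNilDegree D (mon 0 1) w) (hw : 0 < w) (hp : 0 < p) (hN : q * P.natDegree = i + j)
    (hj : 0 < j) (hP0 : P ≠ 0)
    (hG : HasNilDegree D
      (MvPolynomial.aeval ![mon p 0, mon 0 q] (P.homogenize P.natDegree)) (i * w)) :
    ∃ r e, P.IsRoot r ∧ e < q * w ∧ HasNilDegree D (mon p 0 - r • mon 0 q) e := by
  by_contra! hlarge
  have hne (r : k) : (mon p 0 - r • mon 0 q : SymbolRing k) ≠ 0 := by
    intro h0
    have := congrArg (fun f : SymbolRing k => f.coeff (p, 0)) h0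
    simp [coeff_mon, hp.ne] at this
  have hnil (r : k) : mon p 0 - r • mon 0 q ∈ nilSubalgebra D := by
    have hx' : mon 0 1 ∈ nilSubalgebra D := ⟨_, hx.2⟩
    have := sub_mem (pow_mem hh p) ((nilSubalgebra D).smul_mem (pow_mem hx' q) r)
    simpa [mon_pow] using this
  obtain ⟨m, hm, hm'⟩ := exists_hasNilDegree_aeval_homogenize_of_forall_root (E := q * w) hP0
    fun r hr => by
      obtain ⟨e, he⟩ := (hnil r).exists_hasNilDegree (hne r)
      exact ⟨e, not_lt.1 fun hlt => hlarge r e hr hlt he, he⟩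
  rw [hm'.unique hG, ← mul_assoc, mul_comm P.natDegree, hN, add_mul] at hm
  have := Nat.mul_pos hj hw
  omega

theorem euler_of_mem_weightEq {q p W : ℤ} (hf : f ∈ weightEq k q p W) :
    (q : k) • (mon 1 0 * dh f) + (p : k) • xdx f = (W : k) • f := by
  let T : SymbolRing k →ₗ[k] SymbolRing k :=
    (q : k) • LinearMap.mulLeft k (mon 1 0) ∘ₗ dh.toLinearMap + (p : k) • xdx.toLinearMap -
      (W : k) • LinearMap.id
  suffices T f ∈ (⊥ : Submodule k (SymbolRing k)) from sub_eq_zero.1 this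
  refine map_mem_of_mem_supp T (fun s l hsl => ?_) hf
  have hdh : mon 1 0 * dh (mon s l : SymbolRing k) = (s : k) • mon s l := by
    rcases s with _ | s
    · simp [dh_mon]
    · rw [dh_mon, mul_smul_comm, mon_mul_mon, Nat.add_sub_cancel, zero_add, add_comm 1 s]
  change (q : k) • (mon 1 0 * dh (mon s l : SymbolRing k)) + (p : k) • xdx (mon s l) -
    (W : k) • mon s l = 0
  rw [hdh, xdx_mon, ← hsl]
  push_cast
  module

theorem dh_mul_mon (hP : P.natDegree ≤ N + 1)
    (hf : f * mon 0 i = MvPolynomial.aeval ![mon (p + 1) 0, mon 0 q] (P.homogenize (N + 1))) :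
    dh f * mon 0 i = MvPolynomial.aeval ![mon (p + 1) 0, mon 0 q] (P.derivative.homogenize N) *
      ((p + 1 : k) • mon p 0) := by
  have := derivation_aeval_homogenize (a := mon (p + 1) 0) (b := mon 0 q) dh (by simp [dh_mon]) hP
  rw [← hf, Derivation.leibniz, dh_mon, dh_mon] at this
  simpa [mul_comm] using this

theorem nilDegree_sub_smul_eq [CharZero k] (hh : HasNilDegree (bracket f) (mon 1 0) m)
    (hx : HasNilDegree (bracket f) (mon 0 1) (w + 1))
    (ha : HasNilDegree (bracket f) (mon (p + 1) 0) E) (hb : HasNilDegree (bracket f) (mon 0 q) E)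
    (hu : HasNilDegree (bracket f) (mon (p + 1) 0 - r • mon 0 q) e) (he : e < E)
    (hP : P.natDegree ≤ N + 1) (hP0 : P ≠ 0) (hr : P.IsRoot r)
    (hf : f * mon 0 i = MvPolynomial.aeval ![mon (p + 1) 0, mon 0 q] (P.homogenize (N + 1)))
    (hG : HasNilDegree (bracket f) (f * mon 0 i) (i * (w + 1))) : e = p * m + 1 := by
  have hP'0 : derivative P ≠ 0 := fun h0 =>
    (natDegree_pos_iff_degree_pos.2 (degree_pos_of_root hP0 hr)).ne' (derivative_eq_zero.1 h0)
  have hM : 0 < P.rootMultiplicity r := (rootMultiplicity_pos hP0).2 hr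
  have hdf := dh_mul_mon hP hf
  have hp : (p + 1 : k) ≠ 0 := Nat.cast_add_one_ne_zero p
  have hscal : HasNilDegree (bracket f) ((p + 1 : k) • mon p 0) (p * m) := by
    rw [Algebra.smul_def, ← zero_add (p * m)]
    exact (hasNilDegree_algebraMap hp).mul (hasNilDegree_mon_left hh p)
  have hP' := (hasNilDegree_aeval_homogenize ha hb hu he
    (natDegree_derivative_le P |>.trans (by omega : _ ≤ N)) hP'0).mul hscal
  rw [← hdf, derivative_rootMultiplicity_of_root hr] at hP'
  have hleft := hx.apply.mul (hx.pow i)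
  have heq : bracket f (mon 0 1) * mon 0 1 ^ i = mon 0 1 * (dh f * mon 0 i) := by
    rw [bracket_x, mon_pow]
    simp only [mul_zero, mul_one]
    ring
  have h1 := (heq ▸ hleft).unique (hx.mul hP')
  rw [hf] at hG
  have h2 := hG.unique (hasNilDegree_aeval_homogenize ha hb hu he hP hP0)
  obtain ⟨M, hM⟩ := Nat.exists_eq_succ_of_ne_zero hM.ne'
  rw [hM, Nat.succ_mul] at h2
  rw [hM, Nat.succ_sub_one] at h1
  rw [Nat.succ_eq_add_one, Nat.add_sub_add_right] at h2
  omega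

theorem X_sub_C_mul_derivative_sub (Q : k[X]) (r : k) (M : ℕ) :
    (X - C r) * derivative ((X - C r) ^ M * Q) - C (M : k) * ((X - C r) ^ M * Q) =
      (X - C r) ^ (M + 1) * derivative Q := by
  rcases M with _ | M
  · simp
  · simp only [derivative_mul, derivative_X_sub_C_pow, Nat.add_sub_cancel, map_natCast]
    ring

theorem bracket_sub_smul_of_mem_weightEq (hf : f ∈ weightEq k q 1 j) (r : k) :
    bracket f (mon 1 0 - r • mon 0 q) =
      (q : k) • ((mon 1 0 - r • mon 0 q) * dh f) - (j : k) • f := by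
  have := euler_of_mem_weightEq hf
  push_cast at this
  rw [← this, bracket_apply]
  simp only [map_sub, xdx_mon, Int.cast_zero, zero_smul, Derivation.map_smul, Int.cast_natCast,
    smul_smul, zero_sub, mul_comm, neg_mul, Algebra.smul_mul_assoc, dh_mon, Nat.cast_one,
    tsub_self, mon_zero_zero, one_smul, Nat.cast_zero, zero_tsub, smul_zero, sub_zero, one_mul,
    sub_mul, smul_sub]
  ring

theorem sub_smul_mul_dh_sub_smul_mul_mon (hP : P.natDegree ≤ N + 1)
    (hf : f * mon 0 i = MvPolynomial.aeval ![mon 1 0, mon 0 q] (P.homogenize (N + 1))) (r c : k) :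
    ((mon 1 0 - r • mon 0 q) * dh f - c • f) * mon 0 i =
      MvPolynomial.aeval ![mon 1 0, mon 0 q]
        (((X - C r) * derivative P - C c * P).homogenize (N + 1)) := by
  have hP' : (derivative P).natDegree ≤ N :=
    (natDegree_derivative_le P).trans (Nat.sub_le_iff_le_add.2 hP)
  have hsub := map_sub (homogenizeLM (N + 1)) ((X - C r) * derivative P) (C c * P)
  simp only [homogenizeLM_apply] at hsub
  have hdf := dh_mul_mon (p := 0) hP hf
  simp only [Nat.cast_zero, zero_add, one_smul, mon_zero_zero, mul_one] at hdf
  rw [hsub, map_sub, homogenize_C_mul, map_mul, ← hf, add_comm N 1, aeval_homogenize_mul _ _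
    (natDegree_X_sub_C_le r) hP', aeval_homogenize_X_sub_C, sub_mul, mul_assoc, hdf,
    smul_mul_assoc, MvPolynomial.aeval_C, ← Algebra.smul_def]

theorem rootMultiplicity_le_natDegree (hP0 : P ≠ 0) (r : k) :
    P.rootMultiplicity r ≤ P.natDegree := by
  simpa using natDegree_le_of_dvd (pow_rootMultiplicity_dvd P r) hP0

theorem natDegree_X_sub_C_mul_derivative_sub_le (hP : P.natDegree ≤ N + 1) (r c : k) :
    ((X - C r) * derivative P - C c * P).natDegree ≤ N + 1 := by
  have hP' : (derivative P).natDegree ≤ N :=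
    (natDegree_derivative_le P).trans (Nat.sub_le_iff_le_add.2 hP)
  refine (natDegree_sub_le_of_le ?_ ((natDegree_C_mul_le c P).trans hP)).trans (max_self _).le
  rw [add_comm N 1]
  exact natDegree_mul_le_of_le (natDegree_X_sub_C_le r) hP'

theorem bracket_sub_smul_mul_dh_sub_smul_eq_zero [CharZero k] (hq : 0 < q)
    (hf : f ∈ weightEq k q 1 j) (hr : bracket f (bracket f (mon 1 0 - r • mon 0 q)) = 0) (c : k) :
    bracket f ((mon 1 0 - r • mon 0 q) * dh f - c • f) = 0 := by
  rw [bracket_sub_smul_of_mem_weightEq hf, map_sub, Derivation.map_smul, Derivation.map_smul,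
    bracket_self, smul_zero, sub_zero, smul_eq_zero, or_iff_right (Nat.cast_ne_zero.2 hq.ne')] at hr
  rw [map_sub, Derivation.map_smul, hr, bracket_self, smul_zero, sub_zero]

/-- Both `f` and `u * ∂f/∂h`, where `u = h - r * x ^ q`, are killed by `{f, ·}`, hence so is the
combination whose polynomial vanishes at `r` to higher order than `P`; by the degree formula it is
zero. -/
theorem eq_C_mul_X_sub_C_pow [CharZero k] (hq : 0 < q) (hfw : f ∈ weightEq k q 1 j)
    (ha : HasNilDegree (bracket f) (mon 1 0) E) (hb : HasNilDegree (bracket f) (mon 0 q) E)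
    (hx : HasNilDegree (bracket f) (mon 0 1) w)
    (hu : HasNilDegree (bracket f) (mon 1 0 - r • mon 0 q) 1) (hE : 1 < E)
    (hP : P.natDegree ≤ N + 1) (hP0 : P ≠ 0)
    (hf : f * mon 0 i = MvPolynomial.aeval ![mon 1 0, mon 0 q] (P.homogenize (N + 1)))
    (hG : HasNilDegree (bracket f) (f * mon 0 i) (i * w)) :
    ∃ c, P = C c * (X - C r) ^ P.rootMultiplicity r := by
  set M := P.rootMultiplicity r with hM
  obtain ⟨Q, hQ, -⟩ := exists_eq_pow_rootMultiplicity_mul_and_not_dvd P hP0 r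
  set V : k[X] := (X - C r) * derivative P - C (M : k) * P with hV
  have hVQ : V = (X - C r) ^ (M + 1) * derivative Q := by
    rw [hV, hQ, ← hM, X_sub_C_mul_derivative_sub]
  have hV0 : V = 0 := by
    by_contra hne
    have hVN := natDegree_X_sub_C_mul_derivative_sub_le hP r (M : k)
    have hMV : M + 1 ≤ V.rootMultiplicity r := (le_rootMultiplicity_iff hne).2 ⟨_, hVQ⟩
    have hMN : V.rootMultiplicity r ≤ N + 1 :=
      (rootMultiplicity_le_natDegree hne r).trans hVN
    have hdegV := hasNilDegree_aeval_homogenize ha hb hu hE hVN hne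
    rw [← sub_smul_mul_dh_sub_smul_mul_mon hP hf] at hdegV
    have hg0 := left_ne_zero_of_mul hdegV.ne_zero
    have hDg := bracket_sub_smul_mul_dh_sub_smul_eq_zero hq hfw hu.2 (M : k)
    have hsmallV := hdegV.unique
      ((hasNilDegree_zero_iff.2 ⟨hg0, hDg⟩).mul (hasNilDegree_mon_right hx i))
    rw [hf] at hG
    have hsmall := hG.unique (hasNilDegree_aeval_homogenize ha hb hu hE hP hP0)
    obtain ⟨t, ht⟩ := Nat.exists_eq_add_of_le hMV
    obtain ⟨l, hl⟩ := Nat.exists_eq_add_of_le hMN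
    obtain ⟨E, rfl⟩ := Nat.exists_eq_add_of_le hE
    have h1 : N + 1 - V.rootMultiplicity r = l := by omega
    have h2 : N + 1 - M = l + t + 1 := by omega
    rw [h1] at hsmallV
    rw [← hM, h2] at hsmall
    nlinarith
  rw [hVQ, mul_eq_zero, or_iff_right (pow_ne_zero _ (X_sub_C_ne_zero r)),
    derivative_eq_zero] at hV0
  refine ⟨Q.coeff 0, ?_⟩
  rw [mul_comm, ← eq_C_of_natDegree_eq_zero hV0]
  exact hQ

end Edge

end SymbolRing

namespace SymbolRing

section Edge

variable {k : Type*} [Field k] {f : SymbolRing k} {P : k[X]} {i j n p q N m w M : ℕ}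

theorem coeff_mul_mon (f : SymbolRing k) (s : ℕ) (l l' : ℤ) :
    (f * mon 0 l').coeff (s, l) = f.coeff (s, l - l') := by
  rw [mon, AddMonoidAlgebra.coeff_mul_single_eq_coeff_mul (s, l - l'), mul_one]
  rintro ⟨s', t⟩ -
  simp [eq_sub_iff_add_eq]

theorem exists_natDegree_eq_mul_mon_eq_aeval_homogenize (hp : 0 < p) (hq : 0 < q)
    (hpq : p.Coprime q) (hN : q * N = i + j) (hf : f ∈ weightEq k q p (p * j))
    (hsupp : f ∈ supp fun _ l => -i ≤ l) (hj : f.coeff (0, j) ≠ 0)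
    (hi : f.coeff (p * N, -i) ≠ 0) :
    ∃ P : k[X], P.natDegree = N ∧ P.coeff 0 ≠ 0 ∧
      f * mon 0 i = MvPolynomial.aeval ![mon p 0, mon 0 q] (P.homogenize N) := by
  have hf' : f ∈ supp fun s l => q * s + p * l = p * j ∧ -i ≤ l :=
    mem_supp.2 fun s l hs => ⟨mem_supp.1 hf s l hs, mem_supp.1 hsupp s l hs⟩
  obtain ⟨P, hP, hPf⟩ := exists_mul_mon_eq_aeval_homogenize hp hq hpq hN hf'
  have hcoeff {s t : ℕ} (hst : s + t = N) :
      P.coeff s = f.coeff (s * p, ((t * q : ℕ) : ℤ) - i) := by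
    rw [← coeff_aeval_homogenize_mon hq hst (p := p), ← hPf, coeff_mul_mon]
  refine ⟨P, le_antisymm hP (le_natDegree_of_ne_zero ?_), ?_, hPf⟩
  · rw [hcoeff (Nat.add_zero N)]
    simpa [mul_comm] using hi
  · rw [hcoeff (Nat.zero_add N), mul_comm N q, hN]
    simpa using hj

/-- If `h`, `x` have degrees `m`, `w`, the degree of `f * x ^ i` can be computed in two ways. -/
theorem eq_zero_of_degree_count (hi : 0 < i) (hij : i ≤ j) (hw : 0 < w) (hN : q * N = i + j)
    (hM : M ≤ N) (hmw : (p + 1) * m = q * w)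
    (hcount : i * w = M * (p * m + 1) + (N - M) * (q * w)) : p = 0 := by
  obtain ⟨L, rfl⟩ := Nat.exists_eq_add_of_le hM
  rw [Nat.add_sub_cancel_left] at hcount
  have hMm : M * m = M + j * w := by
    zify at *
    linear_combination M * hmw + w * hN + hcount
  by_contra hp
  have hqM : q * M ≤ 2 * j := by nlinarith
  have hle : q * M + j * ((p + 1) * m) ≤ 2 * j * m := by
    rw [hmw]
    nlinarith
  have hM0 : q * M = 0 := by
    have : 2 * (j * m) ≤ (p + 1) * (j * m) := Nat.mul_le_mul_right _ (by omega)
    nlinarith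
  have hq : q ≠ 0 := by
    rintro rfl
    omega
  obtain rfl := (mul_eq_zero.1 hM0).resolve_left hq
  have := Nat.mul_pos (hi.trans_le hij) hw
  omega

theorem dh_ne_zero [CharZero k] (hq : 0 < q) (hP : P.natDegree = N + 1)
    (hf : f * mon 0 i = MvPolynomial.aeval ![mon (p + 1) 0, mon 0 q] (P.homogenize (N + 1))) :
    dh f ≠ 0 := by
  intro h0
  have hdf := dh_mul_mon hP.le hf
  rw [h0, zero_mul, eq_comm, mul_eq_zero, or_iff_left
    (smul_ne_zero (Nat.cast_add_one_ne_zero p) (mon_ne_zero _ _))] at hdf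
  have hcoeff := coeff_aeval_homogenize_mon (p := p + 1) (P := derivative P) hq (Nat.add_zero N)
  rw [hdf, coeff_derivative, ← hP, coeff_natDegree] at hcoeff
  refine mul_ne_zero (leadingCoeff_ne_zero.2 ?_) (Nat.cast_add_one_ne_zero N) hcoeff.symm
  rintro rfl
  simp at hP

/-- The case of `exists_mul_mon_eq_smul_sub_pow` in which the weight is primitive. -/
theorem exists_eq_C_mul_X_sub_C_pow [IsAlgClosed k] [CharZero k] (hq : 0 < q) (hi : 0 < i)
    (hij : i ≤ j) (hN : q * (N + 1) = i + j) (hf : f ∈ weightEq k q (p + 1) ((p + 1) * j))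
    (hP : P.natDegree = N + 1) (hP0 : P.coeff 0 ≠ 0)
    (hPf : f * mon 0 i = MvPolynomial.aeval ![mon (p + 1) 0, mon 0 q] (P.homogenize (N + 1)))
    (hh : IsNilAt (bracket f) (mon 1 0)) (hx : IsNilAt (bracket f) (mon 0 1)) :
    p = 0 ∧ ∃ c r, P = C c * (X - C r) ^ (N + 1) := by
  have hdf := dh_ne_zero hq hP hPf
  obtain ⟨m, hm⟩ := hh.exists_hasNilDegree (mon_ne_zero 1 0)
  obtain ⟨w, hw⟩ := hx.exists_hasNilDegree (mon_ne_zero 0 1)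
  obtain ⟨w, rfl⟩ : ∃ w', w = w' + 1 := by
    refine Nat.exists_eq_succ_of_ne_zero ?_
    rintro rfl
    exact mul_ne_zero hdf (mon_ne_zero 0 1) (bracket_x f ▸ hw.2)
  have hf0 : f ≠ 0 := fun h0 => hdf (by rw [h0, map_zero])
  have hG : HasNilDegree (bracket f) (f * mon 0 i) (i * (w + 1)) := by
    simpa using (hasNilDegree_zero_iff.2 ⟨hf0, bracket_self f⟩).mul (hasNilDegree_mon_right hw i)
  have hb := hasNilDegree_mon_right hw q
  have hPne : P ≠ 0 := fun h0 => hP0 (by rw [h0, coeff_zero])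
  obtain ⟨r, e, hr, he, hu⟩ := exists_hasNilDegree_sub_smul_lt hh hw w.succ_pos p.succ_pos
    (hP ▸ hN) (hi.trans_le hij) hPne (by rwa [hP, ← hPf])
  have hr0 : r ≠ 0 := by
    rintro rfl
    exact hP0 (by rwa [coeff_zero_eq_eval_zero])
  have ha := hu.of_sub_smul hb he hr0
  have hmw : (p + 1) * m = q * (w + 1) :=
    (hasNilDegree_mon_left hm (p + 1)).unique ha
  obtain rfl := nilDegree_sub_smul_eq hm hw ha hb hu he hP.le hPne hr hPf hG
  have hM := rootMultiplicity_le_natDegree hPne r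
  have hcount := (hPf ▸ hG).unique
    (hasNilDegree_aeval_homogenize ha hb hu he hP.le hPne)
  obtain rfl := eq_zero_of_degree_count hi hij w.succ_pos hN (hP ▸ hM) hmw hcount
  obtain ⟨c, hc⟩ := eq_C_mul_X_sub_C_pow hq (by simpa using hf) ha hb hw (by simpa using hu)
    (by simpa using he) hP.le hPne (by simpa using hPf) hG
  have hdeg : P.natDegree = P.rootMultiplicity r := by
    have hc0 : c ≠ 0 := fun h0 => hPne (by rw [hc, h0, C_0, zero_mul])
    conv_lhs => rw [hc, natDegree_C_mul hc0, natDegree_pow, natDegree_X_sub_C, mul_one]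
  exact ⟨rfl, c, r, by rwa [← hdeg, hP] at hc⟩

theorem exists_mul_mon_eq_smul_sub_pow [IsAlgClosed k] [CharZero k] (hn : 0 < n) (hi : 0 < i)
    (hij : i ≤ j) (hf : f ∈ weightEq k (i + j) (n * i) (n * i * j))
    (hsupp : f ∈ supp fun _ l => -i ≤ l) (hj : f.coeff (0, j) ≠ 0)
    (hni : f.coeff (n * i, -i) ≠ 0) (hh : IsNilAt (bracket f) (mon 1 0))
    (hx : IsNilAt (bracket f) (mon 0 1)) :
    ∃ (c r : k) (q : ℕ), q * (n * i) = i + j ∧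
      f * mon 0 i = c • (mon 1 0 - r • mon 0 q) ^ (n * i) := by
  obtain ⟨N, p, q, hN, hpq, hp, hq⟩ := Nat.exists_coprime' (m := n * i) (n := i + j)
    (Nat.gcd_pos_of_pos_left _ (Nat.mul_pos hn hi))
  obtain ⟨N, rfl⟩ := Nat.exists_eq_succ_of_ne_zero hN.ne'
  have hp0 : 0 < p := Nat.pos_of_mul_pos_right (hp ▸ Nat.mul_pos hn hi)
  have hq0 : 0 < q := Nat.pos_of_mul_pos_right (hq ▸ Nat.add_pos_left hi j)
  have hfw : f ∈ weightEq k q p (p * j) := by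
    refine supp_mono (fun s l hsl => ?_) hf
    have hp' : (n * i : ℤ) = p * N.succ := by exact_mod_cast hp
    have hq' : (i + j : ℤ) = q * N.succ := by exact_mod_cast hq
    rw [hp', hq'] at hsl
    exact mul_right_cancel₀ (Nat.cast_ne_zero.2 N.succ_ne_zero) (by linear_combination hsl)
  obtain ⟨P, hP, hP0, hPf⟩ := exists_natDegree_eq_mul_mon_eq_aeval_homogenize hp0 hq0 hpq hq.symm
    hfw hsupp hj (hp ▸ hni)
  obtain ⟨p, rfl⟩ := Nat.exists_eq_succ_of_ne_zero hp0.ne'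
  obtain ⟨rfl, c, r, rfl⟩ := exists_eq_C_mul_X_sub_C_pow hq0 hi hij hq.symm (by simpa using hfw)
    hP hP0 hPf hh hx
  refine ⟨c, r, q, ?_, ?_⟩
  · rw [hp, hq]
    ring
  · rw [hPf, homogenize_C_mul, map_mul, MvPolynomial.aeval_C, ← Algebra.smul_def,
      aeval_homogenize_X_sub_C_pow, hp]
    simp

end Edge

end SymbolRing

section LeftIdeal

variable {k S : Type*} [CommRing k] [Ring S] [Algebra k S] {u w H : S}

theorem aeval_add_mul_sub_mem_span (h : u * H = (H - 1) * u) (w : S) (r : k[X]) :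
    aeval (H + w * u) r - aeval H r ∈ Ideal.span {u} := by
  induction r using Polynomial.induction_on' with
  | add P Q hP hQ =>
    rw [map_add, map_add, add_sub_add_comm]
    exact add_mem hP hQ
  | monomial s c =>
    rw [aeval_monomial, aeval_monomial, ← mul_sub]
    refine Ideal.mul_mem_left _ _ ?_
    induction s with
    | zero => simp
    | succ s ih =>
      have hs : u * H ^ s = (H - 1) ^ s * u := SemiconjBy.pow_right h s
      have hsplit : (H + w * u) ^ (s + 1) - H ^ (s + 1) =
          (H + w * u) * ((H + w * u) ^ s - H ^ s) + w * (H - 1) ^ s * u := by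
        rw [mul_assoc, ← hs, pow_succ', pow_succ', mul_sub, add_mul _ _ (H ^ s), mul_assoc]
        abel
      rw [hsplit]
      exact add_mem (Ideal.mul_mem_left _ _ ih)
        (Ideal.mul_mem_left _ _ (Ideal.mem_span_singleton_self u))

end LeftIdeal

namespace ClassicalGWA

section Triangular

open SymbolRing

variable {k : Type*} [Field k] {a : k[X]}

theorem algHom_ext_of_isRightRegular {S : Type*} [Ring S] [Algebra k S]
    {F G : ClassicalGWA a →ₐ[k] S} (hX : IsRightRegular (G (genX a)))
    (hH : F (genH a) = G (genH a)) (hFX : F (genX a) = G (genX a)) : F = G := by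
  refine algHom_ext hH hFX (hX ?_)
  change F (genY a) * G (genX a) = G (genY a) * G (genX a)
  rw [← hFX, ← map_mul, hFX, ← map_mul, genY_mul_genX, ← aeval_algHom_apply, ← aeval_algHom_apply,
    hH]

theorem exists_algHom_genH_add_mul (ha : a ≠ 0) {w : ClassicalGWA a} (hw : Commute w (genX a)) :
    ∃ F : ClassicalGWA a →ₐ[k] ClassicalGWA a,
      F (genH a) = genH a + w * genX a ∧ F (genX a) = genX a := by
  obtain ⟨Y, hY⟩ := Ideal.mem_span_singleton'.1
    (aeval_add_mul_sub_mem_span (genX_mul_genH a) w a)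
  have hrel : (Y + genY a) * genX a = aeval (genH a + w * genX a) a := by
    rw [add_mul, hY, genY_mul_genX, sub_add_cancel]
  have hcomm : genX a * (genH a + w * genX a) = (genH a + w * genX a - 1) * genX a := by
    rw [mul_add, genX_mul_genH, ← mul_assoc, ← hw.eq, add_sub_right_comm, add_mul]
  obtain ⟨F, hH, hX, -⟩ := exists_algHom_of_isRightRegular (isRightRegular_genX ha) hcomm hrel
  exact ⟨F, hH, hX⟩

theorem exists_algEquiv_genH_add_smul (ha : a ≠ 0) (c : k) (q : ℕ) :
    ∃ F : ClassicalGWA a ≃ₐ[k] ClassicalGWA a,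
      F (genH a) = genH a + c • genX a ^ (q + 1) ∧ F (genX a) = genX a := by
  have hex (c : k) : ∃ F : ClassicalGWA a →ₐ[k] ClassicalGWA a,
      F (genH a) = genH a + c • genX a ^ (q + 1) ∧ F (genX a) = genX a := by
    simpa only [smul_mul_assoc, ← pow_succ] using
      exists_algHom_genH_add_mul ha (((Commute.refl (genX a)).pow_left q).smul_left c)
  obtain ⟨F, hFH, hFX⟩ := hex c
  obtain ⟨G, hGH, hGX⟩ := hex (-c)
  have hcancel (b d : ClassicalGWA a) {c c' : k} (h : c + c' = 0) : b + c • d + c' • d = b := by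
    rw [add_assoc, ← add_smul, h, zero_smul, add_zero]
  refine ⟨.ofAlgHom F G (algHom_ext_of_isRightRegular (isRightRegular_genX ha) ?_ ?_)
    (algHom_ext_of_isRightRegular (isRightRegular_genX ha) ?_ ?_), hFH, hFX⟩ <;>
  simp [hFH, hFX, hGH, hGX, hcancel]

variable {z : ClassicalGWA a} {W : ℤ} {c : k} {q m : ℕ}

theorem hasLeadingForm_sym_genH_add_smul_pow_mul (hq : 0 < q) (i l : ℕ) :
    HasLeadingForm q 1 (q * i + l) (sym a ((genH a + c • genX a ^ q) ^ i * genX a ^ l))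
      (translateH (c • mon 0 q) (mon i l)) := by
  rw [translateH_mon]
  induction i with
  | zero =>
    simp only [pow_zero, one_mul, sym_genX_pow]
    exact hasLeadingForm_self (mon_mem_supp (by simp))
  | succ i ih =>
    have hbase : HasLeadingForm q 1 q (sym a (genH a + c • genX a ^ q))
        (mon 1 0 + c • mon 0 q) := by
      rw [map_add, map_smul, sym_genH, sym_genX_pow]
      exact hasLeadingForm_self (add_mem (mon_mem_supp (by simp))
        (Submodule.smul_mem _ c (mon_mem_supp (by simp))))
    have := hasLeadingForm_starMul hbase ih (by exact_mod_cast hq)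
    rw [← sym_mul, ← mul_assoc, ← mul_assoc, ← pow_succ', ← pow_succ'] at this
    convert this using 1
    push_cast
    ring

theorem sym_map_sub_translateH_mem_weightLE_of_nonneg (ha : a ≠ 0) (hq : 0 < q)
    {F : ClassicalGWA a →ₐ[k] ClassicalGWA a} (hFH : F (genH a) = genH a + c • genX a ^ q)
    (hFX : F (genX a) = genX a) (hz : sym a z ∈ supp fun i l => q * i + l ≤ W ∧ 0 ≤ l) :
    sym a (F z) - translateH (c • mon 0 q) (sym a z) ∈ weightLE k q 1 (W - 1) := by
  let T : SymbolRing k →ₗ[k] ClassicalGWA a := linOfMon fun i l => genH a ^ i * genX a ^ l.toNat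
  have hT : T (sym a z) = z := by
    refine sym_injective ha (sub_eq_zero.1 ?_)
    refine map_mem_of_mem_supp (M := ⊥) (sym a ∘ₗ T - LinearMap.id) (fun i l hil => ?_) hz
    obtain ⟨m, rfl⟩ := Int.eq_ofNat_of_zero_le hil.2
    have hmon : sym a (T (mon i m)) = mon i m := by
      rw [linOfMon_mon, Int.toNat_natCast, sym_mul_genX_pow, mon_eq_pow_mul i]
      simpa [sym_one] using
        congrArg (· * mon 0 (m : ℤ)) (sym_aeval_mul (1 : ClassicalGWA a) (X ^ i))
    exact sub_eq_zero.2 hmon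
  let D : SymbolRing k →ₗ[k] SymbolRing k :=
    sym a ∘ₗ F.toLinearMap ∘ₗ T - (translateH (c • mon 0 q)).toLinearMap
  suffices D (sym a z) ∈ weightLE k q 1 (W - 1) by simpa [D, hT] using this
  refine map_mem_of_mem_supp D (fun i l hil => ?_) hz
  obtain ⟨m, rfl⟩ := Int.eq_ofNat_of_zero_le hil.2
  have hform := (hasLeadingForm_sym_genH_add_smul_pow_mul (a := a) (c := c) hq i m).sub_mem_weightLE
  simpa [D, T, hFH, hFX, linOfMon_mon] using weightLE_mono (sub_le_sub_right hil.1 1) hform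

theorem sym_map_sub_translateH_mem_weightLE (ha : a ≠ 0) (hq : 0 < q)
    {F : ClassicalGWA a →ₐ[k] ClassicalGWA a} (hFH : F (genH a) = genH a + c • genX a ^ q)
    (hFX : F (genX a) = genX a) (hz : sym a z ∈ weightLE k q 1 W)
    (hm : sym a z ∈ supp fun _ l => -m ≤ l) :
    sym a (F z) - translateH (c • mon 0 q) (sym a z) ∈ weightLE k q 1 (W - 1) := by
  have hzm : sym a (z * genX a ^ m) ∈ supp fun i l => q * i + l ≤ W + m ∧ 0 ≤ l := by
    rw [sym_mul_genX_pow]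
    refine mul_mem_supp (P := fun i l => q * i + 1 * l ≤ W ∧ -m ≤ l)
      (Q := fun i l => i = 0 ∧ l = m) ?_ ?_ (mon_mem_supp ⟨rfl, rfl⟩)
    · rintro i l _ _ ⟨hW, hl⟩ ⟨rfl, rfl⟩
      constructor <;> push_cast <;> linarith
    · exact mem_supp.2 fun i l hil => ⟨mem_supp.1 hz i l hil, mem_supp.1 hm i l hil⟩
  have hmem := sym_map_sub_translateH_mem_weightLE_of_nonneg ha hq hFH hFX hzm
  rw [map_mul, map_pow, hFX, sym_mul_genX_pow, sym_mul_genX_pow, map_mul, translateH_mon, pow_zero,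
    one_mul, ← sub_mul] at hmem
  have hcancel := mul_mem_weightLE hmem (mon_mem_supp (by simp) : mon 0 (-m) ∈ weightLE k q 1 (-m))
  rw [mul_assoc, mon_mul_mon, add_neg_cancel, add_zero, mon_zero_zero, mul_one] at hcancel
  exact weightLE_mono (by linarith) hcancel

end Triangular

end ClassicalGWA

namespace SymbolRing

section TranslateWeight

variable {k : Type*} [Field k] {q : ℕ} {W : ℤ} {f : SymbolRing k}

theorem translateH_mon_mem_weightEq (c : k) (i : ℕ) (l : ℤ) :
    translateH (c • mon 0 q) (mon i l) ∈ weightEq k q 1 (q * i + l) := by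
  have hbase : mon 1 0 + c • mon 0 q ∈ weightEq k q 1 q :=
    add_mem (mon_mem_supp (by simp)) (Submodule.smul_mem _ c (mon_mem_supp (by simp)))
  rw [translateH_mon]
  induction i with
  | zero =>
    rw [pow_zero, one_mul]
    exact mon_mem_supp (by simp)
  | succ i ih =>
    rw [pow_succ', mul_assoc]
    convert mul_mem_weightEq hbase ih using 2
    push_cast
    ring

theorem translateH_mem_weightEq (c : k) (hf : f ∈ weightEq k q 1 W) :
    translateH (c • mon 0 q) f ∈ weightEq k q 1 W := by
  refine map_mem_of_mem_supp (translateH (c • mon 0 (q : ℤ))).toLinearMap (fun i l hil => ?_) hf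
  rw [← hil, one_mul]
  exact translateH_mon_mem_weightEq c i l

theorem translateH_mem_weightLE (c : k) (hf : f ∈ weightLE k q 1 W) :
    translateH (c • mon 0 q) f ∈ weightLE k q 1 W := by
  refine map_mem_of_mem_supp (translateH (c • mon 0 (q : ℤ))).toLinearMap (fun i l hil => ?_) hf
  rw [one_mul] at hil
  exact weightLE_mono hil (weightEq_le_weightLE (translateH_mon_mem_weightEq c i l))

theorem HasLeadingForm.of_mul {q p W N : ℤ} (hN : 0 < N) {f f₀ : SymbolRing k}
    (h : HasLeadingForm (N * q) (N * p) (N * W) f f₀) : HasLeadingForm q p W f f₀ := by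
  constructor
  · refine supp_mono (fun i l hil => ?_) h.mem_weightEq
    exact mul_left_cancel₀ hN.ne' (by linear_combination hil)
  · refine supp_mono (fun i l hil => ?_) h.sub_mem_weightLE
    refine Int.le_sub_one_of_lt (lt_of_mul_lt_mul_left ?_ hN.le)
    linarith

end TranslateWeight

end SymbolRing

namespace ClassicalGWA

open SymbolRing

section Shrink

variable {k : Type*} [Field k] {a : k[X]} {z : ClassicalGWA a} {u v : ℕ}

theorem hasLeadingForm_sym_map (ha : a ≠ 0) {q m : ℕ} {W : ℤ} {c : k} (hq : 0 < q)
    {F : ClassicalGWA a →ₐ[k] ClassicalGWA a} (hFH : F (genH a) = genH a + c • genX a ^ q)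
    (hFX : F (genX a) = genX a) {f : SymbolRing k} (hz : HasLeadingForm q 1 W (sym a z) f)
    (hm : sym a z ∈ supp fun _ l => -m ≤ l) :
    HasLeadingForm q 1 W (sym a (F z)) (translateH (c • mon 0 q) f) := by
  refine ⟨translateH_mem_weightEq c hz.mem_weightEq, ?_⟩
  have h1 := sym_map_sub_translateH_mem_weightLE ha hq hFH hFX hz.mem_weightLE hm
  have h2 := translateH_mem_weightLE c hz.sub_mem_weightLE
  rw [map_sub] at h2
  simpa using add_mem h1 h2

theorem sym_mem_supp_of_coeff_right_eq_zero
    (hle : sym a z ∈ weightLE k (u + v) (a.natDegree * v) (a.natDegree * u * v))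
    (hsupp : sym a z ∈ supp fun _ l => -v ≤ l ∧ l ≤ u) (huv : 0 < u + v)
    (h0 : (sym a z).coeff (0, u) = 0) :
    sym a z ∈ supp fun _ l => -v ≤ l ∧ l < u := by
  refine mem_supp.2 fun i l hil => ?_
  obtain ⟨hv, hu⟩ := mem_supp.1 hsupp i l hil
  refine ⟨hv, lt_of_le_of_ne hu ?_⟩
  rintro rfl
  have hw := mem_supp.1 hle i u hil
  have hi : ((u + v : ℕ) : ℤ) * i ≤ 0 := by
    push_cast
    linarith
  have : (i : ℤ) ≤ 0 := nonpos_of_mul_nonpos_right hi (by exact_mod_cast huv)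
  obtain rfl : i = 0 := by omega
  exact hil h0

theorem sym_mem_supp_of_coeff_left_eq_zero (ha : a ≠ 0)
    (hle : sym a z ∈ weightLE k (u + v) (a.natDegree * v) (a.natDegree * u * v))
    (hsupp : sym a z ∈ supp fun _ l => -v ≤ l ∧ l ≤ u) (huv : 0 < u + v)
    (h0 : (sym a z).coeff (a.natDegree * v, -v) = 0) :
    sym a z ∈ supp fun _ l => -v < l ∧ l ≤ u := by
  refine mem_supp_iff_slice.2 fun l hl => ?_
  obtain ⟨hv, hu⟩ := mem_supp_iff_slice.1 hsupp l hl
  refine ⟨lt_of_le_of_ne hv ?_, hu⟩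
  rintro rfl
  have hcoeff := leadingCoeff_ne_zero.2 hl
  have hlow := natDegree_mul_neg_le_natDegree_slice ha hl
  rw [leadingCoeff, coeff_slice] at hcoeff
  have hup := mem_supp.1 hle _ _ hcoeff
  have hdeg : (slice (-v) (sym a z)).natDegree = a.natDegree * v := by
    rw [neg_neg] at hlow
    refine le_antisymm ?_ (by exact_mod_cast hlow)
    have : ((u + v : ℕ) : ℤ) * (slice (-v) (sym a z)).natDegree ≤
        (u + v : ℕ) * (a.natDegree * v : ℕ) := by
      push_cast
      linarith
    exact_mod_cast le_of_mul_le_mul_left this (by exact_mod_cast huv)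
  exact hcoeff (hdeg ▸ h0)

theorem translateH_eq_smul_mon {c r : k} {q m : ℕ} {f : SymbolRing k}
    (hf : f * mon 0 v = c • (mon 1 0 - r • mon 0 q) ^ m) :
    translateH (r • mon 0 q) f = c • mon m (-v) := by
  have h := congrArg (translateH (r • mon 0 (q : ℤ))) hf
  rw [map_mul, map_smul, map_pow, map_sub, map_smul, translateH_mon, translateH_mon,
    translateH_mon, pow_zero, one_mul, one_mul, pow_one, mon_zero_zero, mul_one,
    add_sub_cancel_right] at h
  refine mul_right_cancel₀ (mon_ne_zero 0 v) (h.trans ?_)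
  rw [smul_mul_assoc, mon_mul_mon, mon_pow]
  simp

/-- The triangular automorphism `h ↦ h + r x ^ q` concentrates the hypotenuse of the Newton
polygon in its vertex `h ^ (n * v) * x ^ (-v)`. -/
theorem exists_algEquiv_sym_mem_supp_of_edge (hn : 0 < a.natDegree) (hv : 0 < v)
    (hvu : v ≤ u) (hsupp : sym a z ∈ supp fun _ l => -v ≤ l) {f : SymbolRing k}
    (hf : HasLeadingForm (u + v) (a.natDegree * v) (a.natDegree * u * v) (sym a z) f)
    {c r : k} {q : ℕ} (hq : q * (a.natDegree * v) = u + v)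
    (hpow : f * mon 0 v = c • (mon 1 0 - r • mon 0 q) ^ (a.natDegree * v)) :
    ∃ F : ClassicalGWA a ≃ₐ[k] ClassicalGWA a, sym a (F z) ∈ supp fun _ l => -v ≤ l ∧ l < u := by
  have ha : a ≠ 0 := ne_zero_of_natDegree_gt hn
  have hq0 : 0 < q := Nat.pos_of_mul_pos_right (hq ▸ Nat.add_pos_left (hv.trans_le hvu) v)
  have hqZ : (q * (a.natDegree * v) : ℤ) = u + v := by exact_mod_cast hq
  obtain ⟨F, hFH, hFX⟩ := exists_algEquiv_genH_add_smul ha r (q - 1)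
  rw [Nat.sub_add_cancel hq0] at hFH
  have hlead : HasLeadingForm q 1 u (sym a z) f := by
    refine HasLeadingForm.of_mul (N := a.natDegree * v) (by positivity) ?_
    convert hf using 1
    · linear_combination hqZ
    · rw [mul_one]
    · ring
  have hFz := hasLeadingForm_sym_map (F := F.toAlgHom) ha hq0 hFH hFX hlead hsupp
  rw [translateH_eq_smul_mon hpow] at hFz
  refine ⟨F, mem_supp.2 fun i l hil => ⟨?_, ?_⟩⟩
  · have hw := weight_le_of_coeff_sym_ne_zero ha (by positivity) hFz.mem_weightLE hil
    have hqn : 0 < (q * a.natDegree - 1 : ℤ) := by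
      refine pos_of_mul_pos_left (b := (v : ℤ)) ?_ (by positivity)
      have : (v : ℤ) ≤ u := by exact_mod_cast hvu
      linarith
    exact neg_le.1 (le_of_mul_le_mul_left (by linarith) hqn)
  · by_contra! hl
    have hw := mem_supp.1 hFz.mem_weightLE i l hil
    have hi : i ≠ a.natDegree * v := by
      rintro rfl
      push_cast at hw
      linarith
    have := mem_supp.1 hFz.sub_mem_weightLE i l (by simpa [coeff_mon, hi.symm] using hil)
    linarith [(by positivity : (0 : ℤ) ≤ q * i)]

end Shrink

end ClassicalGWA

namespace ClassicalGWA

open SymbolRing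

variable {k : Type*} [Field k] {a b : k[X]} {z : ClassicalGWA a} {u v : ℕ}

section Swap

theorem exists_algHom_swap (h : b = a.comp (-X)) : ∃ F : ClassicalGWA a →ₐ[k] ClassicalGWA b,
    F (genH a) = 1 - genH b ∧ F (genX a) = genY b ∧ F (genY a) = genX b := by
  have h₁ : genY b * (1 - genH b) = (1 - genH b - 1) * genY b := by
    rw [mul_sub, genY_mul_genH]
    simp only [sub_mul, add_mul, mul_one, one_mul]
    abel
  have h₂ : genX b * (1 - genH b) = (1 - genH b + 1) * genX b := by
    rw [mul_sub, genX_mul_genH]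
    simp only [sub_mul, add_mul, mul_one, one_mul]
    abel
  have h₃ : genY b * genX b = aeval (1 - genH b - 1) a := by
    simp [genY_mul_genX, h, aeval_comp]
  have h₄ : genX b * genY b = aeval (1 - genH b) a := by
    simp [genX_mul_genY, h, aeval_comp]
  exact ⟨lift _ _ _ h₁ h₂ h₃ h₄, lift_genH .., lift_genX .., lift_genY ..⟩

theorem exists_algEquiv_swap (a : k[X]) :
    ∃ F : ClassicalGWA a ≃ₐ[k] ClassicalGWA (a.comp (-X)),
      F (genH a) = 1 - genH _ ∧ F (genX a) = genY _ ∧ F (genY a) = genX _ := by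
  obtain ⟨F, hFH, hFX, hFY⟩ := exists_algHom_swap (a := a) rfl
  obtain ⟨G, hGH, hGX, hGY⟩ := exists_algHom_swap (a := a.comp (-X)) (b := a)
    (by simp [comp_assoc])
  exact ⟨.ofAlgHom F G (algHom_ext (by simp [hFH, hGH]) (by simp [hGX, hFY]) (by simp [hGY, hFX]))
    (algHom_ext (by simp [hFH, hGH]) (by simp [hGY, hFX]) (by simp [hGX, hFY])), hFH, hFX, hFY⟩

variable {F : ClassicalGWA a →ₐ[k] ClassicalGWA b}

theorem map_homGen_of_swap (hX : F (genX a) = genY b) (hY : F (genY a) = genX b) (l : ℤ) :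
    F (homGen a l) = homGen b (-l) := by
  obtain ⟨m, rfl | rfl⟩ := l.eq_nat_or_neg
  · rw [homGen_natCast, homGen_neg_natCast, map_pow, hX]
  · rw [neg_neg, homGen_natCast, homGen_neg_natCast, map_pow, hY]

theorem slice_sym_map_ofCoeffs_of_swap (hH : F (genH a) = 1 - genH b)
    (hX : F (genX a) = genY b) (hY : F (genY a) = genX b) (f : ℤ →₀ k[X]) (l : ℤ) :
    slice l (sym b (F (ofCoeffs a f))) = (f (-l)).comp (1 - X) * homGenCoeff b l := by
  induction f using Finsupp.induction_linear with
  | zero => simp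
  | add f g hf hg => simp only [map_add, hf, hg, Finsupp.add_apply, add_comp, add_mul]
  | single l' r =>
    have hr : F (aeval (genH a) r) = aeval (genH b) (r.comp (1 - X)) := by
      simp [← aeval_algHom_apply, hH, aeval_comp]
    rw [ofCoeffs_single, map_mul, hr, map_homGen_of_swap hX hY, ← ofCoeffs_single,
      slice_sym_ofCoeffs, Finsupp.single_apply, Finsupp.single_apply]
    by_cases h : l' = -l
    · rw [if_pos h, if_pos (neg_eq_iff_eq_neg.2 h)]
    · rw [if_neg h, if_neg fun h' => h (neg_eq_iff_eq_neg.1 h'), zero_comp]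

theorem sym_map_mem_supp_of_swap (hH : F (genH a) = 1 - genH b) (hX : F (genX a) = genY b)
    (hY : F (genY a) = genX b) (ha : a ≠ 0) (hz : sym a z ∈ supp fun _ l => -v ≤ l ∧ l ≤ u) :
    sym b (F z) ∈ supp fun _ l => -u ≤ l ∧ l ≤ v := by
  obtain ⟨f, rfl⟩ := ofCoeffs_surjective a z
  refine mem_supp_iff_slice.2 fun l hl => ?_
  rw [slice_sym_map_ofCoeffs_of_swap hH hX hY] at hl
  have hfl : f (-l) ≠ 0 := fun h0 => hl (by simp [h0])
  have := mem_supp_iff_slice.1 hz (-l)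
    (slice_sym_ofCoeffs (a := a) f (-l) ▸ mul_ne_zero hfl (homGenCoeff_ne_zero ha _))
  omega

end Swap

section Reduction

theorem mem_range_aeval_genX (ha : a ≠ 0) (hz : sym a z ∈ supp fun i l => i = 0 ∧ 0 ≤ l) :
    z ∈ (aeval (genX a) : k[X] →ₐ[k] ClassicalGWA a).range := by
  have hmap : sym a z ∈ (aeval (genX a)).range.toSubmodule.map (sym a) := by
    refine map_mem_of_mem_supp LinearMap.id ?_ hz
    rintro i l ⟨rfl, hl⟩
    obtain ⟨m, rfl⟩ := Int.eq_ofNat_of_zero_le hl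
    exact ⟨genX a ^ m, ⟨X ^ m, by simp⟩, sym_genX_pow m⟩
  obtain ⟨z', hz', heq⟩ := hmap
  exact sym_injective ha heq ▸ hz'

variable [CharZero k]

theorem mem_range_aeval_genX_of_isAdNilpotent (ha : a ≠ 0) (hz : IsAdNilpotent z)
    (hsupp : sym a z ∈ supp fun _ l => 0 ≤ l ∧ l ≤ u) :
    z ∈ (aeval (genX a) : k[X] →ₐ[k] ClassicalGWA a).range := by
  have hle : sym a z ∈ weightLE k _ _ _ := weight_le_of_isAdNilpotent (u := u + 1) (v := 0) ha hz
    (by omega) (supp_mono (fun _ l hl => by push_cast; omega) hsupp)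
  refine mem_range_aeval_genX ha (mem_supp.2 fun i l hil => ⟨?_, (mem_supp.1 hsupp i l hil).1⟩)
  have hi := mem_supp.1 hle i l hil
  push_cast at hi
  simp only [add_zero, mul_zero, zero_mul] at hi
  have := nonpos_of_mul_nonpos_right hi (by positivity)
  omega

variable [IsAlgClosed k]

theorem exists_algEquiv_sym_mem_supp_of_coeff_ne_zero (hn : 0 < a.natDegree)
    (hz : IsAdNilpotent z) (hv : 0 < v) (hvu : v ≤ u)
    (hsupp : sym a z ∈ supp fun _ l => -v ≤ l ∧ l ≤ u)
    (hle : sym a z ∈ weightLE k (u + v) (a.natDegree * v) (a.natDegree * u * v))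
    (hright : (sym a z).coeff (0, u) ≠ 0) (hleft : (sym a z).coeff (a.natDegree * v, -v) ≠ 0) :
    ∃ F : ClassicalGWA a ≃ₐ[k] ClassicalGWA a, sym a (F z) ∈ supp fun _ l => -v ≤ l ∧ l < u := by
  have ha : a ≠ 0 := ne_zero_of_natDegree_gt hn
  have huv : (0 : ℤ) < u + v := by omega
  have hsupp' : sym a z ∈ supp fun _ l => -v ≤ l := supp_mono (fun _ _ => And.left) hsupp
  obtain ⟨f, hf, hcoeff⟩ : ∃ f, HasLeadingForm (u + v) (a.natDegree * v) (a.natDegree * u * v)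
      (sym a z) f ∧ ∀ (i : ℕ) (l : ℤ), f.coeff (i, l) =
        if (u + v) * i + a.natDegree * v * l = a.natDegree * u * v then (sym a z).coeff (i, l)
          else 0 :=
    ⟨_, hasLeadingForm_topPart hle, coeff_topPart _⟩
  have hnil {i : ℕ} {l : ℤ} := isNilAt_bracket_mon_of_isAdNilpotent ha hz huv hf (i := i) (l := l)
  obtain ⟨c, r, q, hq, hpow⟩ := exists_mul_mon_eq_smul_sub_pow (j := u) (f := f) hn hv hvu
    (supp_mono (fun i l hil => by linear_combination hil) hf.mem_weightEq)
    (mem_supp.2 fun i l hil =>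
      mem_supp.1 hsupp' i l fun h0 => hil (by rw [hcoeff, h0, ite_self]))
    (by rwa [hcoeff, if_pos (by push_cast; ring)])
    (by rwa [hcoeff, if_pos (by push_cast; ring)])
    (hnil (i := 1) (l := 0) (by simp)) (hnil (i := 0) (l := 1) (by simp))
  exact exists_algEquiv_sym_mem_supp_of_edge hn hv hvu hsupp' hf (by omega) hpow

theorem exists_algEquiv_sym_mem_supp_lt (hn : 0 < a.natDegree) (hz : IsAdNilpotent z)
    (hv : 0 < v) (hvu : v ≤ u) (hsupp : sym a z ∈ supp fun _ l => -v ≤ l ∧ l ≤ u) :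
    ∃ (F : ClassicalGWA a ≃ₐ[k] ClassicalGWA a) (u' v' : ℕ), u' + v' < u + v ∧
      sym a (F z) ∈ supp fun _ l => -v' ≤ l ∧ l ≤ u' := by
  have ha : a ≠ 0 := ne_zero_of_natDegree_gt hn
  have huv : 0 < u + v := by omega
  have hle := weight_le_of_isAdNilpotent ha hz huv hsupp
  by_cases hright : (sym a z).coeff (0, u) = 0
  · have := sym_mem_supp_of_coeff_right_eq_zero hle hsupp huv hright
    exact ⟨.refl, u - 1, v, by omega, supp_mono (fun _ l hl => by omega) this⟩
  by_cases hleft : (sym a z).coeff (a.natDegree * v, -v) = 0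
  · have := sym_mem_supp_of_coeff_left_eq_zero ha hle hsupp huv hleft
    exact ⟨.refl, u, v - 1, by omega, supp_mono (fun _ l hl => by omega) this⟩
  · obtain ⟨F, hF⟩ :=
      exists_algEquiv_sym_mem_supp_of_coeff_ne_zero hn hz hv hvu hsupp hle hright hleft
    exact ⟨F, u - 1, v, by omega, supp_mono (fun _ l hl => by omega) hF⟩

theorem exists_algEquiv_mem_range_of_mem_supp (hn : 0 < a.natDegree) (hz : IsAdNilpotent z)
    (hsupp : sym a z ∈ supp fun _ l => -v ≤ l ∧ l ≤ u) :
    ∃ b, (b = a ∨ b = a.comp (-X)) ∧ ∃ e : ClassicalGWA a ≃ₐ[k] ClassicalGWA b,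
      e z ∈ (aeval (genX b) : k[X] →ₐ[k] ClassicalGWA b).range := by
  induction hN : u + v using Nat.strong_induction_on generalizing a u v with
  | _ N ih =>
  wlog hvu : v ≤ u generalizing a u v
  · obtain ⟨F, hFH, hFX, hFY⟩ := exists_algEquiv_swap a
    have hn' : 0 < (a.comp (-X)).natDegree := by simpa [natDegree_comp] using hn
    obtain ⟨b, hb, e, he⟩ := this hn' (hz.map F F.surjective)
      (sym_map_mem_supp_of_swap (F := F.toAlgHom) hFH hFX hFY (ne_zero_of_natDegree_gt hn) hsupp)
      ((add_comm v u).trans hN) (le_of_not_ge hvu)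
    exact ⟨b, hb.symm.imp_left (·.trans (by simp [comp_assoc])), F.trans e, he⟩
  rcases v.eq_zero_or_pos with rfl | hv
  · refine ⟨a, .inl rfl, .refl, mem_range_aeval_genX_of_isAdNilpotent (u := u)
      (ne_zero_of_natDegree_gt hn) hz ?_⟩
    simpa using hsupp
  · obtain ⟨F, u', v', hlt, hF⟩ := exists_algEquiv_sym_mem_supp_lt hn hz hv hvu hsupp
    obtain ⟨b, hb, e, he⟩ := ih _ (hN ▸ hlt) hn (hz.map F F.surjective) hF rfl
    exact ⟨b, hb, F.trans e, he⟩

theorem exists_algEquiv_mem_range_of_isAdNilpotent (hn : 0 < a.natDegree)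
    (hz : IsAdNilpotent z) :
    ∃ b, (b = a ∨ b = a.comp (-X)) ∧ ∃ e : ClassicalGWA a ≃ₐ[k] ClassicalGWA b,
      e z ∈ (aeval (genX b) : k[X] →ₐ[k] ClassicalGWA b).range := by
  obtain ⟨m, hm⟩ := exists_mem_supp_neg_le_le (sym a z)
  exact exists_algEquiv_mem_range_of_mem_supp hn hz hm

end Reduction

end ClassicalGWA

section Taylor

theorem degree_taylor_sub_lt {R : Type*} [CommRing R] {r : R[X]} (hr : r ≠ 0) (c : R) :
    (taylor c r - r).degree < r.degree :=
  degree_sub_lt_right (degree_taylor r c) hr (leadingCoeff_taylor ..)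

variable {R : Type*} [CommRing R] [IsDomain R] [CharZero R] {r : R[X]}

theorem eq_C_of_taylor_eq_self {c : R} (hc : c ≠ 0) (hr : taylor c r = r) :
    r = C (r.eval 0) := by
  have heval (m : ℕ) : r.eval (m * c) = r.eval 0 := by
    induction m with
    | zero => simp
    | succ m ih => rw [Nat.cast_succ, add_one_mul, ← taylor_eval, hr, ih]
  refine eq_of_infinite_eval_eq _ _ (Set.infinite_of_injective_forall_mem
    (f := fun m : ℕ => m * c) (fun m l h => Nat.cast_injective (mul_right_cancel₀ hc h))
    fun m => ?_)
  rw [Set.mem_ofPred_eq, heval, eval_C]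

theorem natDegree_le_one_of_taylor_neg_one_sub_eq_C {d : R} (h : taylor (-1) r - r = C d) :
    r.natDegree ≤ 1 := by
  have hr : r + C d * X = C ((r + C d * X).eval 0) := by
    refine eq_C_of_taylor_eq_self (neg_ne_zero.2 one_ne_zero) ?_
    rw [map_add, eq_add_of_sub_eq h, taylor_mul, taylor_C, taylor_X, C_neg, C_1]
    ring
  rw [eq_sub_of_add_eq hr, ← neg_sub, natDegree_neg]
  compute_degree

end Taylor

namespace SymbolRing

variable {k : Type*} [Field k]

theorem slice_mon (l : ℤ) (i : ℕ) (l' : ℤ) :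
    slice l (mon i l' : SymbolRing k) = if l' = l then X ^ i else 0 :=
  linOfMon_mon _ _ _

theorem slice_mul_x (l : ℤ) (f : SymbolRing k) : slice (l + 1) (f * mon 0 1) = slice l f := by
  suffices slice (l + 1) ∘ₗ LinearMap.mulRight k (mon 0 1) = slice l from
    LinearMap.congr_fun this f
  refine linearMap_ext fun i l' => ?_
  rw [LinearMap.comp_apply, LinearMap.mulRight_apply, mon_mul_mon, slice_mon, slice_mon, add_zero]
  simp only [add_left_inj]

theorem slice_x_mul_shift_one (l : ℤ) (f : SymbolRing k) :
    slice (l + 1) (mon 0 1 * shift 1 f) = taylor (-1) (slice l f) := by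
  suffices slice (l + 1) ∘ₗ LinearMap.mulLeft k (mon 0 1) ∘ₗ (shift 1).toLinearMap =
      taylor (-1) ∘ₗ slice l from LinearMap.congr_fun this f
  refine linearMap_ext fun i l' => ?_
  have hmon : mon 0 1 * shift (1 : k) (mon i l') =
      aeval (mon 1 0) ((X + C (-1 : k)) ^ i) * mon 0 (1 + l') := by
    rw [shift_mon, mul_left_comm, ← mon_zero_add]
    simp only [map_pow, map_add, aeval_X, map_neg, map_one, sub_eq_add_neg]
  rw [LinearMap.comp_apply, LinearMap.comp_apply, LinearMap.comp_apply, LinearMap.mulLeft_apply,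
    AlgHom.toLinearMap_apply, hmon, slice_aeval_mul_mon, slice_mon]
  by_cases hl : l' = l
  · rw [if_pos (by omega), if_pos hl, taylor_X_pow]
  · rw [if_neg (by omega), if_neg hl, map_zero]

end SymbolRing

namespace ClassicalGWA

open SymbolRing

variable {k : Type*} [Field k] {a b : k[X]} {z : ClassicalGWA a}

section LieGenX

theorem lie_genX_genH (a : k[X]) : ⁅genX a, genH a⁆ = -genX a := by
  rw [Ring.lie_def, genX_mul_genH, sub_mul, one_mul, sub_sub_cancel_left]

theorem slice_sym_lie_genX (z : ClassicalGWA a) (l : ℤ) :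
    slice (l + 1) (sym a ⁅genX a, z⁆) = taylor (-1) (slice l (sym a z)) - slice l (sym a z) := by
  rw [Ring.lie_def, map_sub, map_sub, sym_mul, sym_mul, sym_genX, starMul_mon, starMul_mon_zero,
    Int.cast_one, slice_x_mul_shift_one, slice_mul_x]

theorem iterate_lie_genX_eq_zero (ha : a ≠ 0) {m : ℕ}
    (hz : ∀ l, (slice l (sym a z)).degree < m) : (⁅genX a, ·⁆)^[m] z = 0 := by
  induction m generalizing z with
  | zero =>
    refine sym_injective ha (ext_slice fun l => ?_)
    simpa using hz l
  | succ m ih =>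
    rw [Function.iterate_succ_apply]
    refine ih fun l => ?_
    obtain ⟨l, rfl⟩ : ∃ l', l = l' + 1 := ⟨l - 1, by ring⟩
    rw [slice_sym_lie_genX]
    rcases eq_or_ne (slice l (sym a z)) 0 with h0 | h0
    · simp [h0, bot_lt_iff_ne_bot]
    · exact (degree_taylor_sub_lt h0 _).trans_le (Order.le_of_lt_succ (hz l))

theorem isAdNilpotent_genX (ha : a ≠ 0) : IsAdNilpotent (genX a) := by
  intro z
  refine ⟨(sym a z).coeff.support.sup Prod.fst + 1, iterate_lie_genX_eq_zero ha fun l => ?_⟩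
  rw [degree_lt_iff_coeff_zero]
  intro i hi
  rw [coeff_slice]
  by_contra h
  have := Finset.le_sup (f := Prod.fst) (Finsupp.mem_support_iff.2 h)
  dsimp only at this
  omega

theorem slice_sym_eq_zero_of_natDegree_lt (ha : a ≠ 0) {l : ℤ} (hl : l < 0)
    (hz : (slice l (sym a z)).natDegree < a.natDegree) : slice l (sym a z) = 0 := by
  refine eq_zero_of_dvd_of_natDegree_lt (homGenCoeff_dvd_slice_sym z l) (hz.trans_le ?_)
  rw [natDegree_homGenCoeff ha]
  exact Nat.le_mul_of_pos_right _ (by omega)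

variable [CharZero k]

theorem mem_range_aeval_genX_of_commute (ha : 0 < a.natDegree) (hz : Commute (genX a) z) :
    z ∈ (aeval (genX a) : k[X] →ₐ[k] ClassicalGWA a).range := by
  have ha0 : a ≠ 0 := ne_zero_of_natDegree_gt ha
  have hdeg (l : ℤ) : (slice l (sym a z)).natDegree = 0 := by
    refine natDegree_eq_zero.2 ⟨_, (eq_C_of_taylor_eq_self (neg_ne_zero.2 one_ne_zero) ?_).symm⟩
    rw [← sub_eq_zero, ← slice_sym_lie_genX, hz.lie_eq, map_zero, map_zero]
  refine mem_range_aeval_genX ha0 (mem_supp.2 fun i l hil => ?_)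
  rw [← coeff_slice] at hil
  refine ⟨Nat.eq_zero_of_le_zero (hdeg l ▸ le_natDegree_of_ne_zero hil), ?_⟩
  by_contra! hl
  rw [slice_sym_eq_zero_of_natDegree_lt ha0 hl (by rwa [hdeg]), coeff_zero] at hil
  exact hil rfl

/-- In degree `-1`, the coefficient of `z` is a polynomial of degree at most `1` in `h`; being
divisible by `a`, it vanishes. -/
theorem eq_zero_of_lie_genX_eq_algebraMap (ha : 2 ≤ a.natDegree) {d : k}
    (hz : ⁅genX a, z⁆ = algebraMap k _ d) : d = 0 := by
  have hslice := slice_sym_lie_genX z (-1)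
  have hd : slice (-1 + 1) (sym a (algebraMap k (ClassicalGWA a) d)) = C d := by
    have := sym_aeval_mul (a := a) 1 (C d)
    rw [aeval_C, mul_one, sym_one, ← mon_zero_zero] at this
    rw [this, slice_aeval_mul_mon, neg_add_cancel, if_pos rfl]
  rw [hz, hd] at hslice
  have h0 : slice (-1) (sym a z) = 0 :=
    slice_sym_eq_zero_of_natDegree_lt (ne_zero_of_natDegree_gt ha) (by omega)
      ((natDegree_le_one_of_taylor_neg_one_sub_eq_C hslice.symm).trans_lt ha)
  simpa [h0] using hslice

end LieGenX

section Rigidity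

theorem lie_sub_eq_algebraMap_of_lie_eq_neg {S : Type*} [Ring S] [Algebra k S] {x u s t : S}
    {c d : k} (hc : c ≠ 0) (hu : u = c • x + algebraMap k S d) (hus : ⁅u, s⁆ = -u)
    (hxt : ⁅x, t⁆ = -x) : ⁅x, s - t⁆ = algebraMap k S (-(c⁻¹ * d)) := by
  have hxs : c • (x * s - s * x) = -u := by
    rw [← hus, Ring.lie_def, hu, add_mul, mul_add, smul_mul_assoc, mul_smul_comm,
      Algebra.commutes, add_sub_add_right_eq_sub, smul_sub]
  rw [Ring.lie_def] at hxt ⊢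
  calc x * (s - t) - (s - t) * x = c⁻¹ • c • (x * s - s * x) - (x * t - t * x) := by
        rw [inv_smul_smul₀ hc]
        noncomm_ring
    _ = -(c⁻¹ • algebraMap k S d) := by
        rw [hxs, hxt, hu, smul_neg, smul_add, inv_smul_smul₀ hc]
        abel
    _ = algebraMap k S (-(c⁻¹ * d)) := by
        rw [map_neg, map_mul, ← Algebra.smul_def]

theorem aeval_genX_injective :
    Function.Injective (aeval (genX a) : k[X] →ₐ[k] ClassicalGWA a) := by
  have hcoeff (r : k[X]) (i : ℕ) : (sym a (aeval (genX a) r)).coeff (0, (i : ℤ)) = r.coeff i := by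
    induction r using Polynomial.induction_on' with
    | add P Q hP hQ => simp [hP, hQ]
    | monomial s c =>
      rw [aeval_monomial, ← Algebra.smul_def, map_smul, sym_genX_pow,
        AddMonoidAlgebra.coeff_smul_apply, coeff_mon, coeff_monomial]
      simp
  intro P Q h
  ext i
  rw [← hcoeff, h, hcoeff]

theorem dvd_of_aeval_genH_mem_span_genX {r : k[X]}
    (hr : aeval (genH a) r ∈ Ideal.span {genX a}) : a ∣ r := by
  obtain ⟨w, hw⟩ := Ideal.mem_span_singleton'.1 hr
  have hsym := congrArg (slice (-1 + 1)) (congrArg (sym a) hw)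
  rw [← mul_one (aeval _ r), sym_aeval_mul, sym_one, ← mon_zero_zero, slice_aeval_mul_mon,
    neg_add_cancel, if_pos rfl, ← pow_one (genX a), sym_mul_genX_pow, Nat.cast_one,
    ← neg_add_cancel 1, slice_mul_x] at hsym
  simpa [← hsym, homGenCoeff] using homGenCoeff_dvd_slice_sym w (-1)

theorem dvd_comp_of_genH_add_mul_genX {H w : ClassicalGWA a} {γ : k}
    (hH : H = genH a + algebraMap k _ γ + w * genX a) (hb : aeval H b ∈ Ideal.span {genX a}) :
    a ∣ b.comp (X + C γ) := by
  have hcomm : genX a * (genH a + algebraMap k _ γ) = (genH a + algebraMap k _ γ - 1) * genX a := by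
    rw [mul_add, genX_mul_genH, ← Algebra.commutes, add_sub_right_comm, add_mul]
  refine dvd_of_aeval_genH_mem_span_genX ?_
  rw [aeval_comp, map_add, aeval_X, aeval_C]
  rw [hH] at hb
  exact (Submodule.sub_mem_iff_right _ hb).1 (aeval_add_mul_sub_mem_span hcomm w b)

variable [CharZero k]

theorem natDegree_eq_one_of_map_genX_eq_aeval (ha : 0 < a.natDegree)
    (φ : ClassicalGWA a ≃ₐ[k] ClassicalGWA b) {p : k[X]} (hp : φ (genX a) = aeval (genX b) p) :
    p.natDegree = 1 := by
  have hcomm : Commute (genX a) (φ.symm (genX b)) := by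
    have : Commute (φ (genX a)) (genX b) := by
      rw [hp]
      simpa using (Commute.all p X).map (aeval (genX b))
    simpa using this.map φ.symm
  obtain ⟨r, hr⟩ := mem_range_aeval_genX_of_commute ha hcomm
  have hcomp : r.comp p = X := by
    refine aeval_genX_injective (a := b) ?_
    rw [aeval_comp, ← hp, aeval_algHom_apply, aeval_X]
    exact (congrArg φ hr).trans (φ.apply_symm_apply _)
  have := congrArg natDegree hcomp
  rw [natDegree_comp, natDegree_X] at this
  exact Nat.eq_one_of_mul_eq_one_left this

/-- Comparing `[φ x, φ h] = -φ x` with `[x, h] = -x` shows that `φ h - h` commutes with `x`. -/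
theorem dvd_comp_of_map_genX_mem_range (ha : 0 < a.natDegree) (hb : 2 ≤ b.natDegree)
    (φ : ClassicalGWA a ≃ₐ[k] ClassicalGWA b)
    (hφ : φ (genX a) ∈ (aeval (genX b) : k[X] →ₐ[k] ClassicalGWA b).range) :
    ∃ γ, b ∣ a.comp (X + C γ) := by
  obtain ⟨p, hp⟩ := hφ
  obtain ⟨c, hc, d, rfl⟩ := natDegree_eq_one.1
    (natDegree_eq_one_of_map_genX_eq_aeval ha φ hp.symm)
  have hX : φ (genX a) = c • genX b + algebraMap k _ d := by
    rw [← hp]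
    simp [Algebra.smul_def]
  have hlie : ⁅genX b, φ (genH a) - genH b⁆ = algebraMap k _ (-(c⁻¹ * d)) := by
    refine lie_sub_eq_algebraMap_of_lie_eq_neg hc hX ?_ (lie_genX_genH b)
    rw [← map_neg, ← lie_genX_genH, Ring.lie_def, Ring.lie_def, map_sub, map_mul, map_mul]
  have hd : d = 0 := by
    simpa [hc] using eq_zero_of_lie_genX_eq_algebraMap hb hlie
  obtain ⟨r, hr⟩ := mem_range_aeval_genX_of_commute (by omega : 0 < b.natDegree)
    (z := φ (genH a) - genH b) (by
      rw [commute_iff_lie_eq, hlie, hd]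
      simp)
  refine ⟨r.coeff 0, dvd_comp_of_genH_add_mul_genX (H := φ (genH a))
    (w := aeval (genX b) r.divX) ?_ ?_⟩
  · rw [add_assoc, ← sub_eq_iff_eq_add', ← hr]
    conv_lhs => rw [← divX_mul_X_add r]
    simp [add_comm]
  · rw [aeval_algHom_apply φ, ← genY_mul_genX, map_mul, hX, hd]
    exact Ideal.mem_span_singleton'.2 ⟨c • φ (genY a), by simp⟩

variable [IsAlgClosed k]

theorem exists_dvd_comp_of_algEquiv (ha : 0 < a.natDegree) (hb : 2 ≤ b.natDegree)
    (φ : ClassicalGWA a ≃ₐ[k] ClassicalGWA b) :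
    ∃ (b' : k[X]) (γ : k), (b' = b ∨ b' = b.comp (-X)) ∧ b' ∣ a.comp (X + C γ) := by
  obtain ⟨b', hb', e, he⟩ := exists_algEquiv_mem_range_of_isAdNilpotent (by omega)
    ((isAdNilpotent_genX (ne_zero_of_natDegree_gt ha)).map φ φ.surjective)
  have hdeg : 2 ≤ b'.natDegree := by
    rcases hb' with rfl | rfl <;> simpa [natDegree_comp] using hb
  obtain ⟨γ, hγ⟩ := dvd_comp_of_map_genX_mem_range ha hdeg (φ.trans e) he
  exact ⟨b', γ, hb', hγ⟩

end Rigidity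

end ClassicalGWA

section Isomorphisms

namespace ClassicalGWA

variable {k : Type*} [Field k] {a b : k[X]} {c γ : k}

theorem exists_algHom_affine (hb : b ≠ 0) (h : a = C c * b.comp (X + C γ)) :
    ∃ F : ClassicalGWA a →ₐ[k] ClassicalGWA b,
      F (genH a) = genH b - algebraMap k _ γ ∧ F (genX a) = genX b := by
  have h₁ : genX b * (genH b - algebraMap k _ γ) = (genH b - algebraMap k _ γ - 1) * genX b := by
    rw [mul_sub, genX_mul_genH, ← Algebra.commutes]
    simp only [sub_mul, one_mul]
    abel
  have h₄ : (c • genY b) * genX b = aeval (genH b - algebraMap k _ γ) a := by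
    rw [smul_mul_assoc, genY_mul_genX, h, map_mul, aeval_C, aeval_comp, Algebra.smul_def]
    simp
  obtain ⟨F, hH, hX, -⟩ := exists_algHom_of_isRightRegular (isRightRegular_genX hb) h₁ h₄
  exact ⟨F, hH, hX⟩

theorem nonempty_algEquiv_of_eq_C_mul_comp_X_add_C (hc : c ≠ 0) (hb : b ≠ 0)
    (h : a = C c * b.comp (X + C γ)) : Nonempty (ClassicalGWA a ≃ₐ[k] ClassicalGWA b) := by
  have h' : b = C c⁻¹ * a.comp (X + C (-γ)) := by
    rw [h, mul_comp, comp_assoc, C_comp, ← mul_assoc, ← C_mul, inv_mul_cancel₀ hc]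
    simp
  have ha : a ≠ 0 := fun h0 => hb (by rw [h', h0, zero_comp, mul_zero])
  obtain ⟨F, hFH, hFX⟩ := exists_algHom_affine hb h
  obtain ⟨G, hGH, hGX⟩ := exists_algHom_affine ha h'
  exact ⟨.ofAlgHom F G
    (algHom_ext_of_isRightRegular (by simpa [hFX, hGX] using isRightRegular_genX hb)
      (by simp [hFH, hGH]) (by simp [hFX, hGX]))
    (algHom_ext_of_isRightRegular (by simpa [hFX, hGX] using isRightRegular_genX ha)
      (by simp [hFH, hGH]) (by simp [hFX, hGX]))⟩

theorem nonempty_algEquiv_of_eq_C_mul_comp {ε : k} (hε : ε = 1 ∨ ε = -1) (hc : c ≠ 0)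
    (hb : b ≠ 0) (h : a = C c * b.comp (C ε * X + C γ)) :
    Nonempty (ClassicalGWA a ≃ₐ[k] ClassicalGWA b) := by
  rcases hε with rfl | rfl
  · exact nonempty_algEquiv_of_eq_C_mul_comp_X_add_C hc hb (by simpa using h)
  · have hb' : b.comp (-X) ≠ 0 := comp_neg_X_eq_zero_iff.not.2 hb
    have h' : a = C c * (b.comp (-X)).comp (X + C (-γ)) := by simp [h, comp_assoc, add_comm]
    obtain ⟨F⟩ := nonempty_algEquiv_of_eq_C_mul_comp_X_add_C hc hb' h'
    obtain ⟨S, -⟩ := exists_algEquiv_swap b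
    exact ⟨F.trans S.symm⟩

theorem natDegree_le_of_algEquiv [IsAlgClosed k] [CharZero k] (ha : 0 < a.natDegree)
    (φ : ClassicalGWA a ≃ₐ[k] ClassicalGWA b) : b.natDegree ≤ a.natDegree := by
  rcases lt_or_ge b.natDegree 2 with hb | hb
  · omega
  obtain ⟨b', γ, hb', hdvd⟩ := exists_dvd_comp_of_algEquiv ha hb φ
  have ha' : a.comp (X + C γ) ≠ 0 := comp_X_add_C_ne_zero_iff.2 (ne_zero_of_natDegree_gt ha)
  have hle := natDegree_le_of_dvd hdvd ha'
  rcases hb' with rfl | rfl <;> simpa [natDegree_comp] using hle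

theorem exists_eq_C_mul_comp_of_algEquiv [IsAlgClosed k] [CharZero k] (ha : 0 < a.natDegree)
    (hb : 2 ≤ b.natDegree) (φ : ClassicalGWA a ≃ₐ[k] ClassicalGWA b) :
    ∃ ε c γ : k, (ε = 1 ∨ ε = -1) ∧ c ≠ 0 ∧ a = C c * b.comp (C ε * X + C γ) := by
  obtain ⟨b', γ, hb', hdvd⟩ := exists_dvd_comp_of_algEquiv ha hb φ
  obtain ⟨ε, hε, rfl⟩ : ∃ ε : k, (ε = 1 ∨ ε = -1) ∧ b' = b.comp (C ε * X) := by
    rcases hb' with rfl | rfl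
    · exact ⟨1, .inl rfl, by simp⟩
    · exact ⟨-1, .inr rfl, by simp⟩
  have hε0 : ε ≠ 0 := by rcases hε with rfl | rfl <;> simp
  have ha' : a.comp (X + C γ) ≠ 0 := comp_X_add_C_ne_zero_iff.2 (ne_zero_of_natDegree_gt ha)
  have hdeg : (a.comp (X + C γ)).natDegree ≤ (b.comp (C ε * X)).natDegree := by
    simpa [natDegree_comp, hε0] using natDegree_le_of_algEquiv (by omega) φ.symm
  obtain ⟨u, hu⟩ := associated_of_dvd_of_natDegree_le hdvd ha' hdeg
  obtain ⟨c, hc, huc⟩ := isUnit_iff.1 u.isUnit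
  refine ⟨ε, c, -(ε * γ), hε, hc.ne_zero, ?_⟩
  have h := congrArg (·.comp (X - C γ)) hu
  simp only [← huc, mul_comp, comp_assoc, C_comp, X_comp, add_comp, sub_add_cancel, comp_X] at h
  rw [← h, mul_comm]
  congr 2
  simp only [map_neg, map_mul]
  ring

theorem exists_eq_C_mul_comp_X_add_C_of_natDegree_eq_one (ha : a.natDegree = 1)
    (hb : b.natDegree = 1) : ∃ c γ : k, c ≠ 0 ∧ a = C c * b.comp (X + C γ) := by
  obtain ⟨u, hu, v, rfl⟩ := natDegree_eq_one.1 ha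
  obtain ⟨s, hs, t, rfl⟩ := natDegree_eq_one.1 hb
  refine ⟨u / s, v / u - t / s, div_ne_zero hu hs, ?_⟩
  have hlin : u = u / s * s := by field_simp
  have hconst : v = u / s * (s * (v / u - t / s) + t) := by field_simp; ring
  simp only [add_comp, mul_comp, C_comp, X_comp]
  conv_lhs => rw [hlin, hconst]
  simp only [map_mul, map_add]
  ring

theorem nonempty_algEquiv_iff [IsAlgClosed k] [CharZero k] (ha : 0 < a.natDegree)
    (hb : 0 < b.natDegree) :
    Nonempty (ClassicalGWA a ≃ₐ[k] ClassicalGWA b) ↔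
      ∃ ε c γ : k, (ε = 1 ∨ ε = -1) ∧ c ≠ 0 ∧ a = C c * b.comp (C ε * X + C γ) := by
  refine ⟨fun ⟨φ⟩ => ?_, fun ⟨ε, c, γ, hε, hc, h⟩ =>
    nonempty_algEquiv_of_eq_C_mul_comp hε hc (ne_zero_of_natDegree_gt hb) h⟩
  by_cases hb2 : 2 ≤ b.natDegree
  · exact exists_eq_C_mul_comp_of_algEquiv ha hb2 φ
  · have ha1 : a.natDegree = 1 := by have := natDegree_le_of_algEquiv hb φ.symm; omega
    obtain ⟨c, γ, hc, h⟩ :=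
      exists_eq_C_mul_comp_X_add_C_of_natDegree_eq_one (b := b) ha1 (by omega)
    exact ⟨1, c, γ, .inl rfl, hc, by simpa using h⟩

end ClassicalGWA

end Isomorphisms

section Roots

theorem exists_equiv_of_map_univ_eq {ι κ T : Type*} [Fintype ι] [Fintype κ] {f : ι → T}
    {g : κ → T} (h : Finset.univ.val.map f = Finset.univ.val.map g) :
    ∃ e : ι ≃ κ, ∀ i, g (e i) = f i := by
  classical
  have hcard (t : T) : Fintype.card {i // f i = t} = Fintype.card {i // g i = t} := by
    have hcount := congrArg (Multiset.count t) h
    rw [Multiset.count_map, Multiset.count_map] at hcount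
    rw [Fintype.card_subtype, Fintype.card_subtype, Finset.card_def, Finset.card_def,
      Finset.filter_val, Finset.filter_val]
    simpa only [eq_comm] using hcount
  exact ⟨Equiv.ofFiberEquiv fun t => Fintype.equivOfCardEq (hcard t), Equiv.ofFiberEquiv_map _⟩

variable {k : Type*} [Field k] {ι κ : Type*}

theorem forall_sub_sq_eq_iff_exists_sign [NeZero (2 : k)] {u v : ι → k} (i₀ : ι) :
    (∀ i j, (u i - u j) ^ 2 = (v i - v j) ^ 2) ↔
      ∃ ε : k, (ε = 1 ∨ ε = -1) ∧ ∀ i, u i - u i₀ = ε * (v i - v i₀) := by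
  constructor
  · intro h
    by_cases hv : ∃ j, v j - v i₀ ≠ 0
    · obtain ⟨j, hj⟩ := hv
      have hpolar (i : ι) : (u i - u i₀) * (u j - u i₀) = (v i - v i₀) * (v j - v i₀) :=
        mul_left_cancel₀ (two_ne_zero (α := k)) (by linear_combination h i i₀ + h j i₀ - h i j)
      rcases sq_eq_sq_iff_eq_or_eq_neg.1 (h j i₀) with huv | huv
      · refine ⟨1, .inl rfl, fun i => mul_right_cancel₀ hj ?_⟩
        linear_combination hpolar i - (u i - u i₀) * huv
      · refine ⟨-1, .inr rfl, fun i => mul_right_cancel₀ hj ?_⟩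
        linear_combination (u i - u i₀) * huv - hpolar i
    · push Not at hv
      exact ⟨1, .inl rfl, fun i => by simpa [hv i] using h i i₀⟩
  · rintro ⟨ε, hε, h⟩ i j
    have hε2 : ε ^ 2 = 1 := by rcases hε with rfl | rfl <;> ring
    have huv : u i - u j = ε * (v i - v j) := by linear_combination h i - h j
    rw [huv, mul_pow, hε2, one_mul]

variable [Fintype ι] [Fintype κ]

theorem roots_prod_X_sub_C_eq_map (u : ι → k) :
    (∏ i, (X - C (u i))).roots = Finset.univ.val.map u := by
  simpa using roots_multiset_prod_X_sub_C (Finset.univ.val.map u)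

theorem C_mul_prod_X_sub_C_eq_iff {c d : k} (hc : c ≠ 0) {u : ι → k} {v : κ → k} :
    C c * ∏ i, (X - C (u i)) = C d * ∏ i, (X - C (v i)) ↔
      c = d ∧ ∃ e : ι ≃ κ, ∀ i, v (e i) = u i := by
  constructor
  · intro h
    obtain rfl : c = d := by simpa [leadingCoeff_prod] using congrArg leadingCoeff h
    refine ⟨rfl, exists_equiv_of_map_univ_eq ?_⟩
    rw [← roots_prod_X_sub_C_eq_map u, ← roots_prod_X_sub_C_eq_map v,
      mul_left_cancel₀ (C_ne_zero.2 hc) h]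
  · rintro ⟨rfl, e, he⟩
    rw [← e.prod_comp]
    simp only [he]

theorem prod_X_sub_C_comp_C_mul_X_add_C {ε : k} (hε : ε ^ 2 = 1) (v : κ → k) (γ : k) :
    (∏ i, (X - C (v i))).comp (C ε * X + C γ) =
      C (ε ^ Fintype.card κ) * ∏ i, (X - C (ε * (v i - γ))) := by
  rw [prod_comp, ← Finset.card_univ, C_pow, ← Finset.prod_const, ← Finset.prod_mul_distrib]
  refine Finset.prod_congr rfl fun i _ => ?_
  have hCε : (C ε : k[X]) ^ 2 = 1 := by rw [← C_pow, hε, C_1]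
  simp only [sub_comp, X_comp, C_comp, map_mul, map_sub]
  linear_combination (C (v i) - C γ) * hCε

theorem exists_C_mul_prod_eq_C_mul_comp_iff {s t : k} (hs : s ≠ 0) (ht : t ≠ 0) (u : ι → k)
    (v : κ → k) (i₀ : ι) :
    (∃ ε c γ : k, (ε = 1 ∨ ε = -1) ∧ c ≠ 0 ∧
      C s * ∏ i, (X - C (u i)) = C c * (C t * ∏ i, (X - C (v i))).comp (C ε * X + C γ)) ↔
      ∃ (e : ι ≃ κ) (ε : k), (ε = 1 ∨ ε = -1) ∧
        ∀ i, u i - u i₀ = ε * (v (e i) - v (e i₀)) := by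
  constructor
  · rintro ⟨ε, c, γ, hε, -, h⟩
    rw [mul_comp, C_comp, prod_X_sub_C_comp_C_mul_X_add_C (sq_eq_one_iff.2 hε), ← mul_assoc,
      ← mul_assoc, ← C_mul, ← C_mul, C_mul_prod_X_sub_C_eq_iff hs] at h
    obtain ⟨-, e, he⟩ := h
    exact ⟨e, ε, hε, fun i => by linear_combination he i₀ - he i⟩
  · rintro ⟨e, ε, hε, h⟩
    have hε2 : ε ^ 2 = 1 := sq_eq_one_iff.2 hε
    have hεκ : ε ^ Fintype.card κ ≠ 0 := pow_ne_zero _ fun h0 => by simp [h0] at hε2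
    refine ⟨ε, s / (t * ε ^ Fintype.card κ), v (e i₀) - ε * u i₀, hε,
      div_ne_zero hs (mul_ne_zero ht hεκ), ?_⟩
    rw [mul_comp, C_comp, prod_X_sub_C_comp_C_mul_X_add_C hε2, ← mul_assoc, ← mul_assoc, ← C_mul,
      ← C_mul, C_mul_prod_X_sub_C_eq_iff hs, mul_assoc, div_mul_cancel₀ _ (mul_ne_zero ht hεκ)]
    exact ⟨rfl, e, fun i => by linear_combination u i₀ * hε2 - h i⟩

theorem exists_equiv_fin_iff {n m : ℕ} {P : (Fin n → Fin m) → Prop} :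
    (∃ e : Fin n ≃ Fin m, P e) ↔
      ∃ (h : n = m) (τ : Equiv.Perm (Fin n)), P fun i => Fin.cast h (τ i) := by
  constructor
  · rintro ⟨e, he⟩
    obtain rfl := Fin.equiv_iff_eq.1 ⟨e⟩
    exact ⟨rfl, e, he⟩
  · rintro ⟨rfl, τ, hτ⟩
    exact ⟨τ, hτ⟩

end Roots

theorem corollary2p1p6 {k : Type*} [Field k] [IsAlgClosed k] [CharZero k]
    (a₁ a₂ : k[X]) (ha₁ : 0 < a₁.natDegree) (ha₂ : 0 < a₂.natDegree)
    (α : Fin a₁.natDegree → k) (β : Fin a₂.natDegree → k)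
    (hα : a₁ = C a₁.leadingCoeff * ∏ i, (X - C (α i)))
    (hβ : a₂ = C a₂.leadingCoeff * ∏ i, (X - C (β i))) :
    List.TFAE [
      Nonempty (GWA (sigmaCl k) a₁ ≃ₐ[k] GWA (sigmaCl k) a₂),
      ∃ e : a₁.natDegree = a₂.natDegree, ∃ τ : Equiv.Perm (Fin a₁.natDegree),
        ∀ i j, (α i - α j) ^ 2 = (β (Fin.cast e (τ i)) - β (Fin.cast e (τ j))) ^ 2,
      ∃ e : a₁.natDegree = a₂.natDegree, ∃ τ : Equiv.Perm (Fin a₁.natDegree),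
        ∃ ε : k, (ε = 1 ∨ ε = -1) ∧
          ∀ i, α i - α ⟨0, ha₁⟩ =
            ε * (β (Fin.cast e (τ i)) - β (Fin.cast e (τ ⟨0, ha₁⟩)))] := by
  tfae_have 2 ↔ 3 := exists_congr fun _ => exists_congr fun _ =>
    forall_sub_sq_eq_iff_exists_sign _
  tfae_have 1 ↔ 3 := by
    have hc₁ : a₁.leadingCoeff ≠ 0 := leadingCoeff_ne_zero.2 (ne_zero_of_natDegree_gt ha₁)
    have hc₂ : a₂.leadingCoeff ≠ 0 := leadingCoeff_ne_zero.2 (ne_zero_of_natDegree_gt ha₂)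
    rw [ClassicalGWA.nonempty_algEquiv_iff ha₁ ha₂, ← exists_equiv_fin_iff (P := fun f =>
        ∃ ε : k, (ε = 1 ∨ ε = -1) ∧ ∀ i, α i - α ⟨0, ha₁⟩ = ε * (β (f i) - β (f ⟨0, ha₁⟩))),
      ← exists_C_mul_prod_eq_C_mul_comp_iff hc₁ hc₂, ← hα, ← hβ]
  tfae_finish
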